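/- Let $R$ be an arbitrary (associative, unital) ring. Let $R\text{-proj}$ be the category of finitely generated projective left $R$-modules, $\mathbf{K}^{-,b}(R\text{-proj})$ the homotopy category of bounded-above cochain complexes in $R\text{-proj}$ with bounded cohomology, $\mathbf{K}^{b}(R\text{-proj})$ its full triangulated subcategory of bounded complexes, and $\mathbf{D}_{\rm sg}(R)=\mathbf{K}^{-,b}(R\text{-proj})/\mathbf{K}^{b}(R\text{-proj})$ the Verdier quotient (the singularity category). For complexes $P,Q$ in $R\text{-proj}$ let $\mathrm{Hom}_R(P,Q)$ be the Hom-complex, with $\mathrm{Hom}_R(P,Q)^n=\prod_p \mathrm{Hom}_R(P^p,Q^{n+p})$, and let $\widehat{\mathrm{Hom}}_R(P,Q)$ be its quotient by the subcomplex of bounded morphisms, i.e. of those $(f^p)_p$ with only finitely many nonzero $f^p$. Let $P^*=\mathrm{Hom}_R(P,R)$ be the dual complex of right $R$-modules, and put $\mathrm{Tor}^R_n(P^*,Q)=H^{-n}(P^*\otimes_R Q)$. Then for all $P,Q$ in $\mathbf{K}^{-,b}(R\text{-proj})$ the following hold. (1) The sequence of complexes of abelian groups $$0\to P^*\otimes_R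 Q\to \mathrm{Hom}_R(P,Q)\to\widehat{\mathrm{Hom}}_R(P,Q)\to 0$$ is exact, where the first map sends $f\otimes x$ to $\bigl(y\mapsto(-1)^{|x||y|}f(y)x\bigr)$ and the second is the projection. (2) There is a long exact sequence of abelian groups $$\cdots\to \mathrm{Tor}^R_{-n}(P^*,Q)\to \mathrm{Hom}_{\mathbf{K}^{-,b}(R\text{-proj})}(P,\Sigma^nQ)\to \mathrm{Hom}_{\mathbf{D}_{\rm sg}(R)}(P,\Sigma^nQ)\to \mathrm{Tor}^R_{-n-1}(P^*,Q)\to\cdots\qquad(n\in\mathbb{Z})$$ whose middle map is induced by the quotient functor $\mathbf{K}^{-,b}(R\text{-proj})\to\mathbf{D}_{\rm sg}(R)$. (3) The sequence in (2) is the long exact cohomology sequence of (1): under the standard isomorphisms $H^n(\mathrm{Hom}_R(P,Q))\cong\mathrm{Hom}_{\mathbf{K}^{-,b}(R\text{-proj})}(P,\Sigma^nQ)$ and suitable isomorphisms $H^n(\widehat{\mathrm{Hom}}_R(P,Q))\cong\mathrm{Hom}_{\mathbf{D}_{\rm sg}(R)}(P,\Sigma^nQ)$, the three kinds of maps in (2)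 are the maps induced on cohomology by the two maps in (1) and the connecting homomorphisms. -/

import Mathlib

open CategoryTheory Limits
open scoped ZeroObject TensorProduct

universe u

namespace SingularityLES

section Categories

variable (R : Type u) [Ring R]

/-- The property of a left `R`-module of being finitely generated and projective. -/
def fgProj : ObjectProperty (ModuleCat.{u} R) :=
  fun M => Module.Finite R M ∧ Module.Projective R M

/-- The category `R-proj` of finitely generated projective left `R`-modules. -/
abbrev FGProj := (fgProj R).FullSubcategory

/-- The inclusion of `R-proj` in the category of all left `R`-modules. -/
abbrev FGProj.incl : FGProj R ⥤ ModuleCat.{u} R := (fgProj R).ι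

instance : (fgProj R).IsClosedUnderIsomorphisms where
  of_iso := by
    rintro M N e ⟨h₁, h₂⟩
    exact ⟨Module.Finite.equiv e.toLinearEquiv, Module.Projective.of_equiv e.toLinearEquiv⟩

instance : (fgProj R).ContainsZero where
  exists_zero := ⟨ModuleCat.of R PUnit.{u + 1}, ModuleCat.isZero_of_subsingleton _,
    (inferInstance : Module.Finite R PUnit.{u + 1}),
    (inferInstance : Module.Projective R PUnit.{u + 1})⟩

instance : HasBinaryBiproducts (FGProj R) where
  has_binary_biproduct M N := by
    obtain ⟨hM₁, hM₂⟩ := M.property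
    obtain ⟨hN₁, hN₂⟩ := N.property
    let B : FGProj R := ⟨ModuleCat.of R (M.obj × N.obj),
      (inferInstance : Module.Finite R (M.obj × N.obj)),
      (inferInstance : Module.Projective R (M.obj × N.obj))⟩
    let b : BinaryBicone M N :=
      { pt := B
        fst := ObjectProperty.homMk (ModuleCat.ofHom (LinearMap.fst R M.obj N.obj))
        snd := ObjectProperty.homMk (ModuleCat.ofHom (LinearMap.snd R M.obj N.obj))
        inl := ObjectProperty.homMk (ModuleCat.ofHom (LinearMap.inl R M.obj N.obj))
        inr := ObjectProperty.homMk (ModuleCat.ofHom (LinearMap.inr R M.obj N.obj)) }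
    refine ⟨⟨b, isBinaryBilimitOfTotal b ?_⟩⟩
    apply ObjectProperty.hom_ext
    apply ModuleCat.hom_ext
    refine LinearMap.ext fun x => ?_
    change ((x.1, (0 : N.obj)) + ((0 : M.obj), x.2) : M.obj × N.obj) = x
    simp

/-- The homotopy category `K(R-proj)` of (unbounded) cochain complexes in `R-proj`. -/
abbrev KProj := HomotopyCategory (FGProj R) (ComplexShape.up ℤ)

/-- The cohomology functor `Hⁱ : K(R-proj) ⥤ R-Mod`; the cohomology of a complex in `R-proj`
is computed in the abelian category of all `R`-modules. -/
noncomputable def cohomology (i : ℤ) : KProj R ⥤ ModuleCat.{u} R :=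
  (FGProj.incl R).mapHomotopyCategory _ ⋙ HomotopyCategory.homologyFunctor _ _ i

instance (i : ℤ) : (cohomology R i).IsHomological := by
  dsimp [cohomology]; infer_instance

/-- The complexes `K` in `K(R-proj)` that are bounded above: `Kⁱ = 0` for all large `i`. -/
def boundedAbove : ObjectProperty (KProj R) :=
  fun K => ∃ n : ℤ, ∀ i, n < i → IsZero (K.as.X i)

/-- The complexes `K` in `K(R-proj)` that are bounded below: `Kⁱ = 0` for all small `i`. -/
def boundedBelow : ObjectProperty (KProj R) :=
  fun K => ∃ n : ℤ, ∀ i, i < n → IsZero (K.as.X i)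

/-- The bounded complexes in `K(R-proj)`. -/
def bounded : ObjectProperty (KProj R) := boundedAbove R ⊓ boundedBelow R

/-- The complexes in `K(R-proj)` with bounded cohomology. -/
def boundedCohomology : ObjectProperty (KProj R) :=
  fun K => ∃ a b : ℤ, ∀ i, (i < a ∨ b < i) → IsZero ((cohomology R i).obj K)

/-- The bounded above complexes with bounded cohomology. -/
def boundedAboveWithBoundedCohomology : ObjectProperty (KProj R) :=
  boundedAbove R ⊓ boundedCohomology R

lemma exists_mappingCone (T : Pretriangulated.Triangle (KProj R)) (hT : T ∈ distTriang (KProj R)) :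
    ∃ (f : T.obj₁.as ⟶ T.obj₂.as), 
      Nonempty (T.obj₃ ≅ (HomotopyCategory.quotient _ _).obj (CochainComplex.mappingCone f)) := by
  obtain ⟨f : T.obj₁.as ⟶ T.obj₂.as, hf⟩ :=
    (HomotopyCategory.quotient _ _).map_surjective T.mor₁
  exact ⟨f, ⟨Pretriangulated.Triangle.π₃.mapIso (Pretriangulated.isoTriangleOfIso₁₂ T _ hT
    (HomotopyCategory.mappingCone_triangleh_distinguished f) (Iso.refl _) (Iso.refl _)
      (by
        rw [← hf]; exact (Category.comp_id _).trans (Category.id_comp _).symm))⟩⟩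

instance : (boundedCohomology R).IsClosedUnderIsomorphisms where
  of_iso := by
    rintro K L e ⟨a, b, h⟩
    exact ⟨a, b, fun i hi => (h i hi).of_iso ((cohomology R i).mapIso e.symm)⟩

lemma isZero_cone_X {K L : CochainComplex (FGProj R) ℤ} (f : K ⟶ L) (i : ℤ)
    (hK : IsZero (K.X (i + 1))) (hL : IsZero (L.X i)) :
    IsZero ((CochainComplex.mappingCone f).X i) := by
  rw [CochainComplex.mappingCone.isZero_X_iff]
  exact ⟨hK, hL⟩

lemma isZero_shift_cohomology_iff (K : KProj R) (n i : ℤ) :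
    IsZero ((cohomology R i).obj (K⟦n⟧)) ↔ IsZero ((cohomology R (n + i)).obj K) := by
  dsimp only [cohomology, Functor.comp_obj]
  refine Iso.isZero_iff (((HomotopyCategory.homologyFunctor _ (.up ℤ) i).mapIso
    ((((FGProj.incl R).mapHomotopyCategory (.up ℤ)).commShiftIso n).app K)) ≪≫
      ((HomotopyCategory.homologyFunctor (ModuleCat R) (.up ℤ) 0).shiftIso n i (n + i) rfl).app _)

instance : (boundedCohomology R).IsTriangulated where
  exists_zero := by
    exact ⟨0, isZero_zero _, 0, 0, fun i _ => (cohomology R i).map_isZero (isZero_zero _)⟩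
  isStableUnderShiftBy n :=
    { le_shift K := by
        rintro ⟨a, b, h⟩
        refine ⟨a - n, b - n, fun i hi => ?_⟩
        rw [isZero_shift_cohomology_iff]
        exact h _ (by lia) }
  toIsTriangulatedClosed₂ := .mk' (by
    rintro T hT ⟨a₁, b₁, h₁⟩ ⟨a₃, b₃, h₃⟩
    refine ⟨min a₁ a₃, max b₁ b₃, fun i hi => ?_⟩
    exact ((cohomology R i).map_distinguished_exact T hT).isZero_of_both_zeros
      ((h₁ i (by lia)).eq_of_src _ _) ((h₃ i (by lia)).eq_of_tgt _ _))

instance : (boundedAbove R).IsStableUnderShift ℤ where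
  isStableUnderShiftBy n :=
    { le_shift K := by
        rintro ⟨a, h⟩
        obtain ⟨K : CochainComplex _ _, rfl⟩ := K.quotient_obj_surjective
        rw [ObjectProperty.prop_shift_iff, HomotopyCategory.shift_quotient_obj]
        exact ⟨a - n, fun i hi => h (i + n) (by lia)⟩ }

instance : (boundedBelow R).IsStableUnderShift ℤ where
  isStableUnderShiftBy n :=
    { le_shift K := by
        rintro ⟨a, h⟩
        obtain ⟨K : CochainComplex _ _, rfl⟩ := K.quotient_obj_surjective
        rw [ObjectProperty.prop_shift_iff, HomotopyCategory.shift_quotient_obj]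
        exact ⟨a - n, fun i hi => h (i + n) (by lia)⟩ }

lemma boundedAbove_cone {K L : KProj R} (f : K.as ⟶ L.as) (hK : boundedAbove R K)
    (hL : boundedAbove R L) :
    boundedAbove R ((HomotopyCategory.quotient _ _).obj (CochainComplex.mappingCone f)) := by
  obtain ⟨a, ha⟩ := hK
  obtain ⟨b, hb⟩ := hL
  exact ⟨max a b, fun i hi => isZero_cone_X R f i (ha _ (by lia)) (hb _ (by lia))⟩

lemma boundedBelow_cone {K L : KProj R} (f : K.as ⟶ L.as) (hK : boundedBelow R K)
    (hL : boundedBelow R L) :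
    boundedBelow R ((HomotopyCategory.quotient _ _).obj (CochainComplex.mappingCone f)) := by
  obtain ⟨a, ha⟩ := hK
  obtain ⟨b, hb⟩ := hL
  exact ⟨min a b - 1, fun i hi => isZero_cone_X R f i (ha _ (by lia)) (hb _ (by lia))⟩

lemma bounded_zero : bounded R ((HomotopyCategory.quotient _ _).obj 0) :=
  ⟨⟨0, fun i _ => (HomologicalComplex.eval _ _ i).map_isZero (isZero_zero _)⟩,
    ⟨0, fun i _ => (HomologicalComplex.eval _ _ i).map_isZero (isZero_zero _)⟩⟩

instance : (boundedAbove R).IsTriangulatedClosed₃ where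
  ext₃' T hT h₁ h₂ := by
    obtain ⟨f, ⟨e⟩⟩ := exists_mappingCone R T hT
    exact ⟨_, boundedAbove_cone R f h₁ h₂, ⟨e⟩⟩

instance : (boundedAbove R).IsTriangulated where
  exists_zero := ⟨_, Functor.map_isZero _ (isZero_zero _), (bounded_zero R).1⟩
  toIsTriangulatedClosed₂ := .of_isTriangulatedClosed₃

instance : (bounded R).IsStableUnderShift ℤ where
  isStableUnderShiftBy n :=
    { le_shift _ hK := ⟨(boundedAbove R).le_shift n _ hK.1, (boundedBelow R).le_shift n _ hK.2⟩ }

instance : (bounded R).IsTriangulatedClosed₃ where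
  ext₃' T hT h₁ h₂ := by
    obtain ⟨f, ⟨e⟩⟩ := exists_mappingCone R T hT
    exact ⟨_, ⟨boundedAbove_cone R f h₁.1 h₂.1, boundedBelow_cone R f h₁.2 h₂.2⟩, ⟨e⟩⟩

instance : (bounded R).IsTriangulated where
  exists_zero := ⟨_, Functor.map_isZero _ (isZero_zero _), bounded_zero R⟩
  toIsTriangulatedClosed₂ := .of_isTriangulatedClosed₃

instance : (boundedAboveWithBoundedCohomology R).IsTriangulated := by
  dsimp only [boundedAboveWithBoundedCohomology]
  infer_instance

/-- The category `K^{-,b}(R-proj)`: the full subcategory of `K(R-proj)` of bounded above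
complexes with bounded cohomology. -/
abbrev KMinusB := (boundedAboveWithBoundedCohomology R).FullSubcategory

/-- The objects of the full subcategory `K^b(R-proj)` of `K^{-,b}(R-proj)`: the bounded complexes,
together with the complexes isomorphic to them in `K(R-proj)` (closing a triangulated subcategory
under isomorphisms does not change the Verdier quotient by it). -/
def homotopyBounded : ObjectProperty (KMinusB R) :=
  (bounded R).isoClosure.inverseImage (boundedAboveWithBoundedCohomology R).ι

instance : (homotopyBounded R).IsTriangulated := by
  dsimp only [homotopyBounded]
  infer_instance

/-- The singularity category `D_sg(R)`: the Verdier quotient `K^{-,b}(R-proj) / K^b(R-proj)`,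
i.e. the localization at the morphisms whose cone is isomorphic to a bounded complex. -/
abbrev Dsg := (homotopyBounded R).trW.Localization

/-- The quotient functor `K^{-,b}(R-proj) ⥤ D_sg(R)`. -/
abbrev quotientFunctor : KMinusB R ⥤ Dsg R := (homotopyBounded R).trW.Q

end Categories

section Tensor

variable (R : Type u) [Ring R] (A : Type u) [AddCommGroup A] [Module Rᵐᵒᵖ A]
  (B : Type u) [AddCommGroup B] [Module R B]

/-- The subgroup of `A ⊗ B` (tensor product over `ℤ`) generated by the elements
`a r ⊗ b - a ⊗ r b`. -/
def balancedRelations : AddSubgroup (A ⊗[ℤ] B) :=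
  AddSubgroup.closure {t | ∃ (a : A) (r : R) (b : B),
    t = (MulOpposite.op r • a) ⊗ₜ[ℤ] b - a ⊗ₜ[ℤ] (r • b)}

/-- The tensor product `A ⊗_R B` of a right `R`-module `A` and a left `R`-module `B` over
a possibly noncommutative ring `R`. -/
def BalancedTensor : Type u := (A ⊗[ℤ] B) ⧸ balancedRelations R A B

instance : AddCommGroup (BalancedTensor R A B) :=
  inferInstanceAs (AddCommGroup ((A ⊗[ℤ] B) ⧸ balancedRelations R A B))

namespace BalancedTensor

variable {A B}

/-- The pure tensor `a ⊗ b`. -/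
def tmul (a : A) (b : B) : BalancedTensor R A B :=
  QuotientAddGroup.mk' (balancedRelations R A B) (a ⊗ₜ[ℤ] b)

variable {R} {C : Type u} [AddCommGroup C]

/-- A biadditive map `f : A × B → C` such that `f (a r, b) = f (a, r b)` induces
an additive map `A ⊗_R B → C`. -/
def lift (f : A →+ B →+ C) (hf : ∀ (a : A) (r : R) (b : B),
    f (MulOpposite.op r • a) b = f a (r • b)) : BalancedTensor R A B →+ C :=
  QuotientAddGroup.lift (balancedRelations R A B)
    (TensorProduct.liftAddHom (R := ℤ) f (by simp)) (by
      rw [balancedRelations, AddSubgroup.closure_le]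
      rintro _ ⟨a, r, b, rfl⟩
      simp [hf])

@[simp]
lemma lift_tmul (f : A →+ B →+ C) (hf : ∀ (a : A) (r : R) (b : B),
    f (MulOpposite.op r • a) b = f a (r • b)) (a : A) (b : B) :
    lift f hf (tmul R a b) = f a b := rfl

lemma tmul_smul (a : A) (r : R) (b : B) :
    tmul R (MulOpposite.op r • a) b = tmul R a (r • b) := by
  rw [← sub_eq_zero]
  exact (QuotientAddGroup.eq_zero_iff _).2 (AddSubgroup.subset_closure ⟨a, r, b, rfl⟩)

lemma add_tmul (a a' : A) (b : B) : tmul R (a + a') b = tmul R a b + tmul R a' b := by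
  simp [tmul, TensorProduct.add_tmul]
  rfl

lemma tmul_add (a : A) (b b' : B) : tmul R a (b + b') = tmul R a b + tmul R a b' := by
  simp [tmul, TensorProduct.tmul_add]
  rfl

lemma hom_ext {f g : BalancedTensor R A B →+ C}
    (h : ∀ a b, f (tmul R a b) = g (tmul R a b)) : f = g := by
  refine QuotientAddGroup.addMonoidHom_ext _ ?_
  ext t
  induction t with
  | zero => simp
  | tmul a b => exact h a b
  | add x y hx hy => rw [map_add, map_add, hx, hy]

variable (R A B) in
/-- The universal biadditive map `A × B → A ⊗_R B`. -/
def tmulHom : A →+ B →+ BalancedTensor R A B :=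
  AddMonoidHom.mk' (fun a => AddMonoidHom.mk' (tmul R a) (tmul_add a))
    (fun a a' => by ext b; exact add_tmul a a' b)

variable {A' B' : Type u} [AddCommGroup A'] [Module Rᵐᵒᵖ A'] [AddCommGroup B'] [Module R B']

/-- The functoriality of `A ⊗_R B`. -/
def map (f : A →ₗ[Rᵐᵒᵖ] A') (g : B →ₗ[R] B') : BalancedTensor R A B →+ BalancedTensor R A' B' :=
  lift (AddMonoidHom.mk' (fun a => (tmulHom R A' B' (f a)).comp g.toAddMonoidHom)
    (fun a a' => by ext; simp)) (fun a r b => by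
      simpa [tmulHom] using tmul_smul (f a) r (g b))

@[simp]
lemma map_tmul (f : A →ₗ[Rᵐᵒᵖ] A') (g : B →ₗ[R] B') (a : A) (b : B) :
    map f g (tmul R a b) = tmul R (f a) (g b) := rfl

end BalancedTensor

/-- The tensor product over `R` as a bifunctor. -/
def tensorBifunctor : ModuleCat.{u} Rᵐᵒᵖ ⥤ ModuleCat.{u} R ⥤ AddCommGrpCat.{u} where
  obj A :=
    { obj B := AddCommGrpCat.of (BalancedTensor R A B)
      map g := AddCommGrpCat.ofHom (BalancedTensor.map LinearMap.id g.hom)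
      map_id _ := AddCommGrpCat.hom_ext (BalancedTensor.hom_ext (fun _ _ => rfl))
      map_comp _ _ := AddCommGrpCat.hom_ext (BalancedTensor.hom_ext (fun _ _ => rfl)) }
  map f :=
    { app B := AddCommGrpCat.ofHom (BalancedTensor.map f.hom LinearMap.id)
      naturality _ _ _ := AddCommGrpCat.hom_ext (BalancedTensor.hom_ext (fun _ _ => rfl)) }
  map_id _ := by
    ext B : 2
    exact AddCommGrpCat.hom_ext (BalancedTensor.hom_ext (fun _ _ => rfl))
  map_comp _ _ := by
    ext B : 2
    exact AddCommGrpCat.hom_ext (BalancedTensor.hom_ext (fun _ _ => rfl))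

instance (A : ModuleCat.{u} Rᵐᵒᵖ) : ((tensorBifunctor R).obj A).Additive where
  map_add := AddCommGrpCat.hom_ext (BalancedTensor.hom_ext
    (fun a _ => BalancedTensor.tmul_add a _ _))

instance : (tensorBifunctor R).Additive where
  map_add := by
    intros
    ext B : 2
    exact AddCommGrpCat.hom_ext (BalancedTensor.hom_ext
      (fun _ b => BalancedTensor.add_tmul _ _ b))

/-- The tensor product `X ⊗_R Y` of a complex of right `R`-modules and a complex of left
`R`-modules: in degree `n` it is the direct sum of the `Xᵖ ⊗_R Y^q` with `p + q = n`,
with differential `d (x ⊗ y) = d x ⊗ y + (-1)ᵖ x ⊗ d y` for `x` in `Xᵖ`. -/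
noncomputable abbrev tensorComplex (X : CochainComplex (ModuleCat.{u} Rᵐᵒᵖ) ℤ)
    (Y : CochainComplex (ModuleCat.{u} R) ℤ) : CochainComplex AddCommGrpCat.{u} ℤ :=
  HomologicalComplex.mapBifunctor X Y (tensorBifunctor R) (ComplexShape.up ℤ)

/-- The hyper-Tor group `Tor_n^R(X, Y) = H^{-n}(X ⊗_R Y)` -/
noncomputable abbrev hyperTor (X : CochainComplex (ModuleCat.{u} Rᵐᵒᵖ) ℤ)
    (Y : CochainComplex (ModuleCat.{u} R) ℤ) (n : ℤ) : AddCommGrpCat.{u} :=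
  (tensorComplex R X Y).homology (-n)

end Tensor

section Hom

variable {R : Type u} [Ring R]

/-- The dual complex `P* = Hom_R(P, R)` of right `R`-modules: in degree `p` it is
`Hom_R(P⁻ᵖ, R)` with `(f r)(x) = f(x) r`, and `d f = -(-1)ᵖ f ∘ d_P` for `f` of degree `p`,
which is the differential of the Hom-complex from `P` to `R` placed in degree zero. -/
def dual (P : CochainComplex (FGProj R) ℤ) : CochainComplex (ModuleCat.{u} Rᵐᵒᵖ) ℤ where
  X p := ModuleCat.of Rᵐᵒᵖ ((P.X (-p)).obj →ₗ[R] R)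
  d p q := q.negOnePow • ModuleCat.ofHom (LinearMap.lcomp Rᵐᵒᵖ R (P.d (-q) (-p)).hom.hom)
  shape p q h := by
    have h' : P.d (-q) (-p) = 0 := P.shape _ _ (fun h' => h (by simp at h' ⊢; lia))
    apply ModuleCat.hom_ext
    ext f x
    simp [h']
  d_comp_d' p q r _ _ := by
    have h' : P.d (-r) (-q) ≫ P.d (-q) (-p) = 0 := P.d_comp_d _ _ _
    have h'' : ∀ x, (P.d (-q) (-p)).hom.hom ((P.d (-r) (-q)).hom.hom x) = 0 := fun x =>
      congr($(h').hom.hom x)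
    apply ModuleCat.hom_ext
    ext f x
    simp [h'']

open CochainComplex CochainComplex.HomComplex

variable (P Q : CochainComplex (FGProj R) ℤ)

/-- The underlying complex of `R`-modules of a complex in `R-proj`. -/
abbrev underlying : CochainComplex (ModuleCat.{u} R) ℤ :=
  ((FGProj.incl R).mapHomologicalComplex _).obj Q

/-- The subgroup of bounded cochains of degree `n` from `P` to `Q`: those with only finitely many
nonzero components `Pᵖ ⟶ Q^(p + n)`. -/
def boundedCochains (n : ℤ) : AddSubgroup (Cochain P Q n) where
  carrier := {z | {p : ℤ | z.v p (p + n) rfl ≠ 0}.Finite}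
  zero_mem' := by simp
  add_mem' {z w} hz hw := (hz.union hw).subset (fun p hp => by
    by_contra h
    simp at h hp
    simp [h] at hp)
  neg_mem' {z} hz := by simpa using hz

lemma δ_mem_boundedCochains {n : ℤ} (m : ℤ) {z : Cochain P Q n} (hz : z ∈ boundedCochains P Q n) :
    δ n m z ∈ boundedCochains P Q m := by
  by_cases hnm : n + 1 = m
  · subst hnm
    have e₁ (p : ℤ) : p + n = p + (n + 1) - 1 := by lia
    have e₂ (p : ℤ) : p + (n + 1) = p + 1 + n := by lia
    refine (hz.union (hz.preimage (f := fun p => p + 1)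
      (fun _ _ _ _ h => by simpa using h))).subset (fun p hp => ?_)
    by_contra h
    simp at h hp
    refine hp ?_
    obtain ⟨h₁, h₂⟩ := h
    have h₃ : ∀ q (hq : q = p + 1 + n), z.v (p + 1) q hq.symm = 0 := by rintro _ rfl; exact h₂
    rw [δ_v n (n + 1) rfl z p (p + (n + 1)) rfl (p + n) (p + 1) (e₁ p) rfl, h₁,
      h₃ (p + (n + 1)) (e₂ p), Limits.zero_comp, Limits.comp_zero, smul_zero, add_zero]
  · rw [δ_shape n m hnm]
    exact zero_mem _

/-- The complex `\widehat{Hom}_R(P, Q)`: the quotient of the Hom-complex by the subcomplex of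
bounded cochains. -/
def homHat : CochainComplex AddCommGrpCat.{u} ℤ where
  X n := AddCommGrpCat.of (Cochain P Q n ⧸ boundedCochains P Q n)
  d n m := AddCommGrpCat.ofHom (QuotientAddGroup.map (boundedCochains P Q n)
    (boundedCochains P Q m) (δ_hom ℤ P Q n m).toAddMonoidHom
      (fun _ hz => δ_mem_boundedCochains P Q m hz))
  shape n m h := by
    apply AddCommGrpCat.hom_ext
    apply QuotientAddGroup.addMonoidHom_ext
    refine AddMonoidHom.ext fun z => ?_
    change ((δ n m z : Cochain P Q m) : Cochain P Q m ⧸ boundedCochains P Q m) = 0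
    rw [δ_shape n m h]
    rfl
  d_comp_d' n m p _ _ := by
    apply AddCommGrpCat.hom_ext
    apply QuotientAddGroup.addMonoidHom_ext
    refine AddMonoidHom.ext fun z => ?_
    change ((δ m p (δ n m z) : Cochain P Q p) : Cochain P Q p ⧸ boundedCochains P Q p) = 0
    rw [δ_δ]
    rfl

/-- The projection `Hom_R(P, Q) ⟶ \widehat{Hom}_R(P, Q)`. -/
def toHomHat : HomComplex P Q ⟶ homHat P Q where
  f n := AddCommGrpCat.ofHom (QuotientAddGroup.mk' (boundedCochains P Q n))
  comm' _ _ _ := rfl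

/-- The morphism `Pᵃ ⟶ Q^q`, `y ↦ f(y) x` attached to `f : Pᵃ ⟶ R` and `x` in `Q^q`. -/
def rankOne {M N : FGProj R} (f : M.obj →ₗ[R] R) (x : N.obj) : M ⟶ N :=
  ObjectProperty.homMk (ModuleCat.ofHom (f.smulRight x))

lemma rankOne_add_right {M N : FGProj R} (f : M.obj →ₗ[R] R) (x y : N.obj) :
    rankOne f (x + y) = rankOne f x + rankOne f y := by
  apply ObjectProperty.hom_ext
  apply ModuleCat.hom_ext
  exact LinearMap.ext fun m => smul_add _ _ _

lemma rankOne_add_left {M N : FGProj R} (f g : M.obj →ₗ[R] R) (x : N.obj) :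
    rankOne (f + g) x = rankOne f x + rankOne g x := by
  apply ObjectProperty.hom_ext
  apply ModuleCat.hom_ext
  exact LinearMap.ext fun m => add_smul _ _ _

lemma rankOne_smul {M N : FGProj R} (f : M.obj →ₗ[R] R) (r : R) (x : N.obj) :
    rankOne (MulOpposite.op r • f) x = rankOne f (r • x) := by
  apply ObjectProperty.hom_ext
  apply ModuleCat.hom_ext
  exact LinearMap.ext fun m => mul_smul _ _ _

lemma rankOne_comp {M N N' : FGProj R} (f : M.obj →ₗ[R] R) (x : N.obj) (g : N ⟶ N') :
    rankOne f x ≫ g = rankOne f (g.hom.hom x) := by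
  apply ObjectProperty.hom_ext
  apply ModuleCat.hom_ext
  exact LinearMap.ext fun m => map_smul g.hom.hom (f m) x

lemma comp_rankOne {M M' N : FGProj R} (g : M' ⟶ M) (f : M.obj →ₗ[R] R) (x : N.obj) :
    g ≫ rankOne f x = rankOne (f.comp g.hom.hom) x := rfl

@[simp]
lemma single_add {p q : ℤ} (f g : P.X p ⟶ Q.X q) (n : ℤ) :
    (Cochain.single (f + g) n : Cochain P Q n) = Cochain.single f n + Cochain.single g n := by
  ext p' q' h
  by_cases hp : p' = p ∧ q' = q
  · obtain ⟨rfl, rfl⟩ := hp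
    simp
  · by_cases hp' : p' = p
    · simp [Cochain.single_v_eq_zero' _ _ p' q' h (fun hq => hp ⟨hp', hq⟩)]
    · simp [Cochain.single_v_eq_zero _ _ p' q' h hp']

lemma single_mem_boundedCochains {p q : ℤ} (f : P.X p ⟶ Q.X q) (n : ℤ) :
    Cochain.single f n ∈ boundedCochains P Q n :=
  (Set.finite_singleton p).subset (fun p' hp' => by
    by_contra h
    exact hp' (Cochain.single_v_eq_zero f n p' (p' + n) rfl h))

/-- The map sending `f ⊗ x`, with `f` in `(P*)ⁱ` and `x` in `Qʲ`, to the cochain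
`y ↦ (-1)^{|x| |y|} f(y) x` (of degree `n = i + j`), which is concentrated on `y` in `P⁻ⁱ`. -/
def tensorToHomX (i j n : ℤ) :
    ((tensorBifunctor R).obj ((dual P).X i)).obj ((underlying Q).X j) ⟶ (HomComplex P Q).X n :=
  AddCommGrpCat.ofHom (BalancedTensor.lift (R := R) (A := (P.X (-i)).obj →ₗ[R] R) (B := (Q.X j).obj)
    (C := Cochain P Q n)
    (AddMonoidHom.mk' (fun f => AddMonoidHom.mk' (fun x =>
      (i * j).negOnePow • Cochain.single (rankOne f x) n)
      (fun x y => by rw [rankOne_add_right, single_add, smul_add]))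
      (fun f g => by ext1 x; simp [rankOne_add_left]))
      (fun f r x => by simp [rankOne_smul]))

lemma tensorToHomX_tmul (i j n : ℤ) (f : (P.X (-i)).obj →ₗ[R] R) (x : (Q.X j).obj) :
    (tensorToHomX P Q i j n).hom (BalancedTensor.tmul R f x) =
      (i * j).negOnePow • (Cochain.single (rankOne f x) n : Cochain P Q n) := rfl

lemma single_units_smul {p q : ℤ} (u : ℤˣ) (f : P.X p ⟶ Q.X q) (n : ℤ) :
    (Cochain.single (u • f) n : Cochain P Q n) = u • Cochain.single f n := by
  obtain rfl | rfl := Int.units_eq_one_or u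
  · simp
  · have h := single_add P Q f (-f) n
    rw [add_neg_cancel, Cochain.single_zero] at h
    simpa using (neg_eq_of_add_eq_zero_right h.symm).symm

lemma rankOne_units_smul {M N : FGProj R} (u : ℤˣ) (f : M.obj →ₗ[R] R) (x : N.obj) :
    rankOne (u • f) x = u • rankOne f x := by
  obtain rfl | rfl := Int.units_eq_one_or u
  · simp
  · apply ObjectProperty.hom_ext
    apply ModuleCat.hom_ext
    refine LinearMap.ext fun m => ?_
    exact (congrArg (· • x) (by simp)).trans (neg_smul (f m) x) |>.trans (by simp; rfl)

lemma δ_single_rankOne (i j i' j' n m : ℤ) (hi : i + 1 = i') (hj : j + 1 = j') (hm : n + 1 = m)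
    (h : i + j = n) (f : (P.X (-i)).obj →ₗ[R] R) (x : (Q.X j).obj) :
    δ n m ((i * j).negOnePow • (Cochain.single (rankOne f x) n : Cochain P Q n)) =
      (i' * j).negOnePow • (Cochain.single (rankOne (i'.negOnePow •
        (f.comp (P.d (-i') (-i)).hom.hom)) x) m : Cochain P Q m) +
      i.negOnePow • ((i * j').negOnePow •
        (Cochain.single (rankOne f ((Q.d j j').hom.hom x)) m : Cochain P Q m)) := by
  rw [δ_units_smul, Cochain.δ_single _ n m hm (-i') j' (by lia) hj, rankOne_comp, comp_rankOne,
    rankOne_units_smul, single_units_smul, smul_add, smul_smul, smul_smul, smul_smul, add_comm]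
  have h₁ : (i * j).negOnePow * m.negOnePow = (i' * j).negOnePow * i'.negOnePow := by
    subst hi hm h
    simp only [← Int.negOnePow_add]
    rw [Int.negOnePow_eq_iff]
    exact ⟨0, by ring⟩
  have h₂ : (i * j).negOnePow = i.negOnePow * (i * j').negOnePow := by
    subst hj
    simp only [← Int.negOnePow_add]
    rw [Int.negOnePow_eq_iff]
    exact ⟨-i, by ring⟩
  rw [h₁, ← h₂]

lemma tensorToHomX_d (i j i' j' n m : ℤ) (hi : i + 1 = i') (hj : j + 1 = j') (hm : n + 1 = m)
    (h : i + j = n) :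
    tensorToHomX P Q i j n ≫ (HomComplex P Q).d n m =
      ((tensorBifunctor R).map ((dual P).d i i')).app ((underlying Q).X j) ≫
          tensorToHomX P Q i' j m +
        i.negOnePow • (((tensorBifunctor R).obj ((dual P).X i)).map ((underlying Q).d j j') ≫
          tensorToHomX P Q i j' m) := by
  apply AddCommGrpCat.hom_ext
  apply BalancedTensor.hom_ext
  intro f x
  exact δ_single_rankOne P Q i j i' j' n m hi hj hm h f x

/-- The canonical morphism `P* ⊗_R Q ⟶ Hom_R(P, Q)`,
`f ⊗ x ↦ (y ↦ (-1)^{|x| |y|} f(y) x)`. -/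
noncomputable def tensorToHom :
    tensorComplex R (dual P) (underlying Q) ⟶ HomComplex P Q where
  f n := HomologicalComplex.mapBifunctorDesc (fun i j _ => tensorToHomX P Q i j n)
  comm' n m hnm := by
    apply HomologicalComplex.mapBifunctor.hom_ext
    intro i j h
    dsimp at hnm h
    subst h hnm
    have e₁ := HomologicalComplex.mapBifunctor.d₁_eq (dual P) (underlying Q)
      (tensorBifunctor R) (ComplexShape.up ℤ)
      (show (ComplexShape.up ℤ).Rel i (i + 1) from rfl) j (i + j + 1) (by dsimp; lia)
    have e₂ := HomologicalComplex.mapBifunctor.d₂_eq (dual P) (underlying Q)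
      (tensorBifunctor R) (ComplexShape.up ℤ)
      i (show (ComplexShape.up ℤ).Rel j (j + 1) from rfl) (i + j + 1) (by dsimp; lia)
    rw [HomologicalComplex.mapBifunctor.d_eq, HomologicalComplex.ι_mapBifunctorDesc_assoc,
      Preadditive.add_comp, Preadditive.comp_add,
      HomologicalComplex.mapBifunctor.ι_D₁_assoc, HomologicalComplex.mapBifunctor.ι_D₂_assoc,
      e₁, e₂, tensorToHomX_d P Q i j (i + 1) (j + 1) _ _ rfl rfl rfl rfl]
    simp only [Linear.units_smul_comp, Category.assoc, HomologicalComplex.ι_mapBifunctorDesc]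
    simp

lemma tensorToHom_comp_toHomHat : tensorToHom P Q ≫ toHomHat P Q = 0 := by
  ext n : 1
  apply HomologicalComplex.mapBifunctor.hom_ext
  intro i j h
  rw [HomologicalComplex.comp_f, tensorToHom, HomologicalComplex.ι_mapBifunctorDesc_assoc]
  apply AddCommGrpCat.hom_ext
  apply BalancedTensor.hom_ext
  intro f x
  refine (QuotientAddGroup.eq_zero_iff _).2 ?_
  refine (boundedCochains P Q n).zsmul_mem (single_mem_boundedCochains P Q _ n) _

/-- The sequence `0 ⟶ P* ⊗_R Q ⟶ Hom_R(P, Q) ⟶ \widehat{Hom}_R(P, Q) ⟶ 0`. -/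
noncomputable def homSequence : ShortComplex (CochainComplex AddCommGrpCat.{u} ℤ) :=
  ShortComplex.mk (tensorToHom P Q) (toHomHat P Q) (tensorToHom_comp_toHomHat P Q)

end Hom

section LongExactSequence

variable {R : Type u} [Ring R]

/-- The tautological identification `H^{-m}(X ⊗_R Y) ≃ Tor_m^R(X, Y)`, with `n = -m`. -/
noncomputable def hyperTorEquiv (X : CochainComplex (ModuleCat.{u} Rᵐᵒᵖ) ℤ)
    (Y : CochainComplex (ModuleCat.{u} R) ℤ) (n m : ℤ) (h : m = -n) :
    (tensorComplex R X Y).homology n ≃+ hyperTor R X Y m :=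
  (eqToIso (congrArg (fun k => (tensorComplex R X Y).homology k) (show n = -m by lia)) :
    (tensorComplex R X Y).homology n ≅ hyperTor R X Y m).addCommGroupIsoToAddEquiv

namespace KMinusB

variable (P Q : KMinusB R)

/-- The cochain complex underlying an object of `K^{-,b}(R-proj)`. -/
abbrev complex : CochainComplex (FGProj R) ℤ := P.obj.as

/-- The identification of morphisms from `P` to `Σⁿ Q` in `K^{-,b}(R-proj)` with homotopy classes
of morphisms of complexes `P ⟶ Σⁿ Q`. -/
noncomputable def homotopyClassEquiv (n : ℤ) :
    ((HomotopyCategory.quotient (FGProj R) (.up ℤ)).obj P.complex ⟶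
      (HomotopyCategory.quotient (FGProj R) (.up ℤ)).obj (Q.complex⟦n⟧)) ≃+ ShiftedHom P Q n :=
  AddEquiv.mk' ((((HomotopyCategory.quotient (FGProj R) (.up ℤ)).commShiftIso n).app Q.complex ≪≫
      ((boundedAboveWithBoundedCohomology R).ι.commShiftIso n).symm.app Q).homToEquiv.trans
    (boundedAboveWithBoundedCohomology R).fullyFaithfulι.homEquiv.symm) (fun f g => by
      apply ObjectProperty.hom_ext
      exact Preadditive.add_comp _ _ _ f g _)

/-- The standard identification `Hⁿ(Hom_R(P, Q)) ≃ Hom_{K^{-,b}(R-proj)}(P, Σⁿ Q)`. -/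
noncomputable def homologyHomEquiv (n : ℤ) :
    (CochainComplex.HomComplex P.complex Q.complex).homology n ≃+ ShiftedHom P Q n :=
  ((CochainComplex.HomComplex.homologyAddEquiv P.complex Q.complex n).trans
    CochainComplex.HomComplex.CohomologyClass.homAddEquiv).trans
      (homotopyClassEquiv P Q n)

/-- The group `Tor_m^R(P*, Q)`. -/
noncomputable abbrev tor (m : ℤ) : AddCommGrpCat.{u} :=
  hyperTor R (dual P.complex) (underlying Q.complex) m

/-- The map `Tor_m^R(P*, Q) ⟶ Hom_{K^{-,b}(R-proj)}(P, Σⁿ Q)`, for `m = -n`, that is induced by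
the canonical morphism `P* ⊗_R Q ⟶ Hom_R(P, Q)`. -/
noncomputable def torToHom (m n : ℤ) (h : m = -n) : tor P Q m →+ ShiftedHom P Q n :=
  ((homologyHomEquiv P Q n).toAddMonoidHom.comp
    (HomologicalComplex.homologyMap (tensorToHom P.complex Q.complex) n).hom).comp
      (hyperTorEquiv (dual P.complex) (underlying Q.complex) n m h).symm.toAddMonoidHom

/-- The map `Hom_{K^{-,b}(R-proj)}(P, Σⁿ Q) ⟶ Hom_{D_sg(R)}(P, Σⁿ Q)` induced by the quotient
functor. -/
noncomputable def quotientMap (n : ℤ) : ShiftedHom P Q n →+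
    ShiftedHom ((quotientFunctor R).obj P) ((quotientFunctor R).obj Q) n :=
  AddMonoidHom.mk' (fun f => f.map (quotientFunctor R)) (by simp [ShiftedHom.map])

end KMinusB

end LongExactSequence

end SingularityLES

/-! Part (1) is checked degreewise. For finitely generated projective `M` a finite dual basis gives
`Hom(M, R) ⊗ N ≃ Hom(M, N)` (`rankOneHom_bijective`). A direct sum of such groups inside the product
over all degrees is exactly the group of cochains with finite support, so `P* ⊗ Q` is, up to signs,
the subcomplex of bounded cochains (`homSequence_shortExact`).

The substance of (2) and (3) is the isomorphism between the cohomology of the quotient complex and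
morphisms in the singularity category. Let `π_m : Q ⟶ σ^{<m} Q` be the projection to a brutal
truncation. Its fibre `σ^{≥m} Q` is bounded because `Q` is bounded above, so `π_m` becomes
invertible in `D_sg` (`toTrunc_mem_trW`). A class in the cohomology of the quotient is given by a
cochain `f` with `δ f` bounded. For `m` small enough `π_m` kills `δ f`, so `f π_m` is a cocycle, and
`f` represents the morphism `[f π_m] π_m⁻¹` of `D_sg`, which does not depend on `m`.

To go back, `π_m` has a degreewise section `s` whose differential is bounded, and `f - f π_m s` is
bounded because `P` is bounded above. If `f` represents zero, the calculus of fractions makes `[f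
π_m]` factor through a bounded complex. Every cochain out of such a complex is bounded, so `f π_m`
is bounded up to a coboundary, and composition with `s` yields the same for `f`
(`represents_zero_iff`). For surjectivity, the denominator of a fraction has a bounded fibre, so
some `π_m` factors through it. The fraction followed by `π_m` is then a genuine cocycle `w`, and `w
s` represents the original morphism (`exists_almostCocycle`).

The connecting map is defined by transport along these isomorphisms, so exactness is that of the
long cohomology sequence of (1). -/

namespace SingularityLES

/-! ### Brutal truncations and their degreewise split sequences. -/

section BrutalTruncation

variable {C : Type*} [Category* C] [Preadditive C] [HasZeroObject C]
  (K : CochainComplex C ℤ) (S : Set ℤ)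

open scoped Classical in
/-- The terms of the brutal truncation of a complex to the degrees in `S`. -/
noncomputable def bruteX (i : ℤ) : C := if i ∈ S then K.X i else 0

open scoped Classical in
/-- The degreewise projection to the brutal truncation. -/
noncomputable def brutePr (i : ℤ) : K.X i ⟶ bruteX K S i :=
  if h : i ∈ S then eqToHom (if_pos h).symm else 0

open scoped Classical in
/-- The degreewise inclusion of the brutal truncation. -/
noncomputable def bruteIn (i : ℤ) : bruteX K S i ⟶ K.X i :=
  if h : i ∈ S then eqToHom (if_pos h) else 0

lemma isZero_bruteX {i : ℤ} (h : i ∉ S) : IsZero (bruteX K S i) := by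
  rw [bruteX, if_neg h]
  exact isZero_zero C

@[simp]
lemma bruteIn_brutePr (i : ℤ) : bruteIn K S i ≫ brutePr K S i = 𝟙 _ := by
  by_cases h : i ∈ S
  · rw [bruteIn, brutePr, dif_pos h, dif_pos h]
    exact eqToHom_trans _ _
  · exact (isZero_bruteX K S h).eq_of_src _ _

lemma brutePr_bruteIn {i : ℤ} (h : i ∈ S) : brutePr K S i ≫ bruteIn K S i = 𝟙 _ := by
  rw [bruteIn, brutePr, dif_pos h, dif_pos h]
  exact eqToHom_trans _ _

lemma brutePr_bruteIn_assoc {i : ℤ} (h : i ∈ S) {Z : C} (g : K.X i ⟶ Z) :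
    brutePr K S i ≫ bruteIn K S i ≫ g = g := by
  rw [← Category.assoc, brutePr_bruteIn K S h, Category.id_comp]

lemma brutePr_eq_zero {i : ℤ} (h : i ∉ S) : brutePr K S i = 0 :=
  (isZero_bruteX K S h).eq_of_tgt _ _

lemma bruteIn_eq_zero {i : ℤ} (h : i ∉ S) : bruteIn K S i = 0 :=
  (isZero_bruteX K S h).eq_of_src _ _

/-- The brutal truncation of a complex to the degrees in an interval `S`. -/
noncomputable def brute [hS : S.OrdConnected] : CochainComplex C ℤ where
  X := bruteX K S
  d i j := bruteIn K S i ≫ K.d i j ≫ brutePr K S j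
  shape i j h := by rw [K.shape i j h, zero_comp, comp_zero]
  d_comp_d' i j k hij hjk := by
    by_cases hi : i ∈ S
    · by_cases hk : k ∈ S
      · have hj : j ∈ S := hS.out hi hk ⟨by simp at hij; lia, by simp at hjk; lia⟩
        simp [brutePr_bruteIn_assoc K S hj]
      · simp [brutePr_eq_zero K S hk]
    · simp [bruteIn_eq_zero K S hi]

/-- The projection of a complex to its brutal truncation to a lower set. -/
noncomputable def bruteπ [S.OrdConnected] (hS : IsLowerSet S) : K ⟶ brute K S where
  f := brutePr K S
  comm' i j hij := by
    dsimp [brute]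
    by_cases hj : j ∈ S
    · have hi : i ∈ S := hS (by simp at hij; lia) hj
      rw [brutePr_bruteIn_assoc K S hi]
    · simp [brutePr_eq_zero K S hj]

/-- The inclusion in a complex of its brutal truncation to an upper set. -/
noncomputable def bruteι [S.OrdConnected] (hS : IsUpperSet S) : brute K S ⟶ K where
  f := bruteIn K S
  comm' i j hij := by
    dsimp [brute]
    by_cases hi : i ∈ S
    · have hj : j ∈ S := hS (by simp at hij; lia) hi
      rw [Category.assoc, Category.assoc, brutePr_bruteIn K S hj, Category.comp_id]
    · simp [bruteIn_eq_zero K S hi]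

/-- The short complex `σ^{≥ m} K ⟶ K ⟶ σ^{< m} K`. -/
noncomputable def bruteShortComplex (m : ℤ) : ShortComplex (CochainComplex C ℤ) where
  X₁ := brute K (Set.Ici m)
  X₂ := K
  X₃ := brute K (Set.Iio m)
  f := bruteι K _ (isUpperSet_Ici m)
  g := bruteπ K _ (isLowerSet_Iio m)
  zero := by
    ext i : 1
    by_cases h : i < m
    · exact (isZero_bruteX K (Set.Ici m) (by simpa using h)).eq_of_src _ _
    · exact (isZero_bruteX K (Set.Iio m) (by simpa using h)).eq_of_tgt _ _

/-- The degreewise splitting of `σ^{≥ m} K ⟶ K ⟶ σ^{< m} K`. -/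
noncomputable def bruteSplitting (m i : ℤ) :
    ((bruteShortComplex K m).map (HomologicalComplex.eval C _ i)).Splitting where
  r := brutePr K (Set.Ici m) i
  s := bruteIn K (Set.Iio m) i
  f_r := bruteIn_brutePr K _ i
  s_g := bruteIn_brutePr K _ i
  id := by
    change brutePr K (Set.Ici m) i ≫ bruteIn K (Set.Ici m) i +
      brutePr K (Set.Iio m) i ≫ bruteIn K (Set.Iio m) i = 𝟙 (K.X i)
    by_cases h : i < m
    · rw [brutePr_eq_zero K (Set.Ici m) (by simpa using h), zero_comp, zero_add]
      exact brutePr_bruteIn K _ h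
    · rw [brutePr_eq_zero K (Set.Iio m) h, zero_comp, add_zero]
      exact brutePr_bruteIn K _ (by simpa using h)

end BrutalTruncation

/-! ### Brutal truncations in `K^{-,b}(R-proj)`, and bounded cochains. -/

section

variable (R : Type u) [Ring R]

lemma bounded_le_boundedCohomology : bounded R ≤ boundedCohomology R := by
  rintro K ⟨⟨b, hb⟩, ⟨a, ha⟩⟩
  refine ⟨a, b, fun i hi => ?_⟩
  have h : IsZero (K.as.X i) := hi.elim (ha i) (hb i)
  let L := ((FGProj.incl R).mapHomologicalComplex _).obj K.as
  exact IsZero.of_iso (ShortComplex.isZero_homology_of_isZero_X₂ (L.sc i)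
    ((FGProj.incl R).map_isZero h))
    ((HomotopyCategory.homologyFunctorFactors (ModuleCat R) (.up ℤ) i).app L)

variable {R}

/-- Degreewise split sequences of complexes give the distinguished triangles of the homotopy
category. -/
lemma brute_triangle_distinguished (K : CochainComplex (FGProj R) ℤ) (m : ℤ) :
    CochainComplex.trianglehOfDegreewiseSplit (bruteShortComplex K m) (bruteSplitting K m) ∈
      distTriang (KProj R) :=
  (HomotopyCategory.distinguished_iff_iso_trianglehOfDegreewiseSplit _).2 ⟨_, _, ⟨Iso.refl _⟩⟩

lemma bounded_brute {K : KProj R} (hK : boundedAbove R K) (m : ℤ) :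
    bounded R ((HomotopyCategory.quotient _ _).obj (brute K.as (Set.Ici m))) := by
  obtain ⟨b, hb⟩ := hK
  refine ⟨⟨b, fun i hi => ?_⟩, ⟨m, fun i hi => isZero_bruteX _ _ (by simpa using hi)⟩⟩
  by_cases h : m ≤ i
  · exact (hb i hi).of_iso (eqToIso (if_pos h))
  · exact isZero_bruteX _ _ h

namespace KMinusB

variable (Q : KMinusB R)

/-- The brutal truncation `σ^{< m} Q`. -/
noncomputable def trunc (m : ℤ) : KMinusB R where
  obj := (HomotopyCategory.quotient _ _).obj (brute Q.complex (Set.Iio m))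
  property := by
    refine ⟨⟨m, fun i hi => isZero_bruteX _ _ (by simp; lia)⟩, ?_⟩
    -- Bounded cohomology passes to the third vertex of the triangle `σ^{≥m} Q ⟶ Q ⟶ σ^{<m} Q`,
    -- whose first vertex is bounded.
    exact (boundedCohomology R).ext_of_isTriangulatedClosed₃ _
      (brute_triangle_distinguished Q.complex m)
      (bounded_le_boundedCohomology R _ (bounded_brute Q.property.1 m)) Q.property.2

/-- The projection `Q ⟶ σ^{< m} Q`, as a morphism of complexes. -/
noncomputable def truncHom (m : ℤ) : Q.complex ⟶ (Q.trunc m).complex :=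
  bruteπ Q.complex _ (isLowerSet_Iio m)

/-- The projection `Q ⟶ σ^{< m} Q`. -/
noncomputable def toTrunc (m : ℤ) : Q ⟶ Q.trunc m :=
  ObjectProperty.homMk ((HomotopyCategory.quotient _ _).map (Q.truncHom m))

/-- The fibre `σ^{≥m} Q` is bounded below by construction and bounded above because `Q` is. -/
lemma toTrunc_mem_trW (m : ℤ) : (homotopyBounded R).trW (Q.toTrunc m) := by
  refine (ObjectProperty.inverseImage_trW_iff _ _ _).2 ?_
  rw [ObjectProperty.trW_isoClosure]
  exact ObjectProperty.trW.mk' _ (brute_triangle_distinguished Q.complex m)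
    (bounded_brute Q.property.1 m)

open CochainComplex CochainComplex.HomComplex

/-- The inclusion of the terms of `σ^{< m} Q` in those of `Q`. -/
noncomputable def truncIn (m i : ℤ) : (Q.trunc m).complex.X i ⟶ Q.complex.X i :=
  bruteIn Q.complex (Set.Iio m) i

/-- The degreewise section of `Q ⟶ σ^{< m} Q`. -/
noncomputable def truncSection (m : ℤ) : Cochain (Q.trunc m).complex Q.complex 0 :=
  Cochain.ofHoms (Q.truncIn m)

lemma truncSection_comp (m : ℤ) :
    (Q.truncSection m).comp (Cochain.ofHom (Q.truncHom m)) (add_zero 0) =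
      Cochain.ofHom (𝟙 (Q.trunc m).complex) := by
  refine Cochain.ext₀ _ _ (fun i => ?_)
  simp only [Cochain.comp_zero_cochain_v, truncSection, Cochain.ofHoms_v, Cochain.ofHom_v]
  exact bruteIn_brutePr Q.complex _ i

lemma truncHom_f_eq_zero {m i : ℤ} (h : m ≤ i) : (Q.truncHom m).f i = 0 :=
  brutePr_eq_zero _ _ (by simpa using h)

lemma isZero_trunc_X {m i : ℤ} (h : m ≤ i) : IsZero ((Q.trunc m).complex.X i) :=
  isZero_bruteX _ _ (by simpa using h)

lemma truncHom_f_comp {m i : ℤ} (h : i < m) :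
    (Q.truncHom m).f i ≫ (Q.truncSection m).v i i (add_zero i) = 𝟙 _ := by
  rw [truncSection, Cochain.ofHoms_v]
  exact brutePr_bruteIn Q.complex _ h

end KMinusB

/-! ### Bounded cochains as a two-sided ideal under composition. -/

section BoundedCochains

open CochainComplex CochainComplex.HomComplex

variable {P Q L : CochainComplex (FGProj R) ℤ}

/-- A set of integers is finite iff it lies in an interval; the interval form is the one that
combines with bounds on complexes. -/
lemma mem_boundedCochains_iff {n : ℤ} {z : Cochain P Q n} :
    z ∈ boundedCochains P Q n ↔
      ∃ a b : ℤ, ∀ p q (h : p + n = q), (p < a ∨ b < p) → z.v p q h = 0 := by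
  constructor
  · intro h
    obtain ⟨a, ha⟩ := Set.Finite.bddBelow h
    obtain ⟨b, hb⟩ := Set.Finite.bddAbove h
    refine ⟨a, b, ?_⟩
    rintro p _ rfl hp
    by_contra h'
    have h₁ := ha h'
    have h₂ := hb h'
    lia
  · rintro ⟨a, b, h⟩
    refine (Set.finite_Icc a b).subset (fun p hp => ?_)
    by_contra h'
    exact hp (h p _ rfl (by simp only [Set.mem_Icc] at h'; lia))

lemma comp_mem_boundedCochains_left {n m k : ℤ} {z : Cochain P Q n}
    (hz : z ∈ boundedCochains P Q n) (w : Cochain Q L m) (h : n + m = k) :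
    z.comp w h ∈ boundedCochains P L k := by
  obtain ⟨a, b, hab⟩ := mem_boundedCochains_iff.1 hz
  refine mem_boundedCochains_iff.2 ⟨a, b, fun p q hpq hp => ?_⟩
  rw [Cochain.comp_v _ _ h p (p + n) q rfl (by lia), hab p _ rfl hp, zero_comp]

lemma comp_mem_boundedCochains_right {n m k : ℤ} (z : Cochain P Q n) {w : Cochain Q L m}
    (hw : w ∈ boundedCochains Q L m) (h : n + m = k) :
    z.comp w h ∈ boundedCochains P L k := by
  obtain ⟨a, b, hab⟩ := mem_boundedCochains_iff.1 hw
  -- The component of the composite in degree `p` involves `w` in degree `p + n`, hence the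
  -- translation by `n`.
  refine mem_boundedCochains_iff.2 ⟨a - n, b - n, fun p q hpq hp => ?_⟩
  rw [Cochain.comp_v _ _ h p (p + n) q rfl (by lia), hab (p + n) _ (by lia) (by lia), comp_zero]

end BoundedCochains

/-! ### The truncation is split up to bounded cochains. -/

namespace KMinusB

open CochainComplex CochainComplex.HomComplex

variable (P Q : KMinusB R)

/-- The degreewise inclusion of `σ^{<m} Q` fails to commute with the differentials only at the cut,
from degree `m - 1` to degree `m`. -/
lemma δ_truncSection_mem (m : ℤ) :
    δ 0 1 (Q.truncSection m) ∈ boundedCochains (Q.trunc m).complex Q.complex 1 := by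
  refine mem_boundedCochains_iff.2 ⟨m - 1, m, fun p q hpq hp => ?_⟩
  obtain hp | hp := hp
  · rw [δ_zero_cochain_v _ _ _ hpq]
    have h := Q.truncHom_f_comp (show q < m by lia)
    have e : (Q.trunc m).complex.d p q = Q.truncIn m p ≫
      Q.complex.d p q ≫ (Q.truncHom m).f q := rfl
    rw [e, Category.assoc, Category.assoc, h, Category.comp_id, truncSection, Cochain.ofHoms_v,
      sub_self]
  · exact (Q.isZero_trunc_X (by lia)).eq_of_src _ _

/-- The difference vanishes where the target degree is below `m`, since there the projection
followed by the section is the identity, and in large degrees because `P` is bounded above. -/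
lemma sub_comp_truncSection_mem {n : ℤ} (f : Cochain P.complex Q.complex n) (m : ℤ) :
    f - (f.comp (Cochain.ofHom (Q.truncHom m)) (add_zero n)).comp (Q.truncSection m) (add_zero n) ∈
      boundedCochains P.complex Q.complex n := by
  obtain ⟨b, hb⟩ := P.property.1
  refine mem_boundedCochains_iff.2 ⟨m - n, b, fun p q hpq hp => ?_⟩
  obtain hp | hp := hp
  · simp only [Cochain.sub_v, Cochain.comp_zero_cochain_v, Cochain.ofHom_v, Category.assoc]
    rw [Q.truncHom_f_comp (by lia), Category.comp_id, sub_self]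
  · exact (hb p hp).eq_of_src _ _

-- Only the lower bound `a` on the support matters: for source degrees at least `a` the target
-- degree is at least `a + n`, where `π_m` vanishes once `m ≤ a + n`.
variable {P Q} in
lemma exists_comp_truncHom_eq_zero {n : ℤ} {f : Cochain P.complex Q.complex n}
    (hf : f ∈ boundedCochains P.complex Q.complex n) :
    ∃ m₀ : ℤ, ∀ m ≤ m₀, f.comp (Cochain.ofHom (Q.truncHom m)) (add_zero n) = 0 := by
  obtain ⟨a, b, hab⟩ := mem_boundedCochains_iff.1 hf
  refine ⟨a + n, fun m hm => ?_⟩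
  ext p q hpq
  rw [Cochain.comp_zero_cochain_v, Cochain.ofHom_v]
  by_cases hp : p < a
  · rw [hab p q hpq (Or.inl hp), zero_comp, Cochain.zero_v]
  · rw [Q.truncHom_f_eq_zero (by lia), comp_zero, Cochain.zero_v]

end KMinusB

end

/-! ### Cohomology of the quotient complex in terms of cochains. -/

section HomologyHat

open CochainComplex CochainComplex.HomComplex

lemma exists_toCycles_of_homologyπ_eq_zero (K : CochainComplex AddCommGrpCat.{u} ℤ) (i j : ℤ)
    (hij : i + 1 = j) (y : K.cycles j) (hy : (K.homologyπ j).hom y = 0) :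
    ∃ x : K.X i, (K.toCycles i j).hom x = y := by
  have hc := K.homologyIsCokernel i j (by simp [← hij])
  have h : (ShortComplex.mk (K.toCycles i j) (K.homologyπ j) (by simp)).Exact :=
    ShortComplex.exact_of_g_is_cokernel _ hc
  exact (ShortComplex.ab_exact_iff _).1 h y hy

lemma iCycles_injective (K : CochainComplex AddCommGrpCat.{u} ℤ) (i : ℤ) :
    Function.Injective (K.iCycles i).hom :=
  (AddCommGrpCat.mono_iff_injective _).1 inferInstance

lemma homologyπ_surjective (K : CochainComplex AddCommGrpCat.{u} ℤ) (i : ℤ) :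
    Function.Surjective (K.homologyπ i).hom :=
  (AddCommGrpCat.epi_iff_surjective _).1 inferInstance

variable {R : Type u} [Ring R] (P Q : CochainComplex (FGProj R) ℤ) (n : ℤ)

/-- The cochains of degree `n` from `P` to `Q` whose differential is bounded. -/
def almostCocycles : AddSubgroup (Cochain P Q n) :=
  (boundedCochains P Q (n + 1)).comap (δ_hom ℤ P Q n (n + 1)).toAddMonoidHom

/-- The class of a cochain modulo bounded cochains. -/
def hatMk : Cochain P Q n →+ (homHat P Q).X n :=
  QuotientAddGroup.mk' (boundedCochains P Q n)

variable {P Q n} in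
lemma hatMk_eq_zero_iff {f : Cochain P Q n} : hatMk P Q n f = 0 ↔ f ∈ boundedCochains P Q n :=
  QuotientAddGroup.eq_zero_iff f

lemma hatMk_surjective : Function.Surjective (hatMk P Q n) :=
  QuotientAddGroup.mk'_surjective _

lemma d_hatMk (m : ℤ) (f : Cochain P Q n) :
    ((homHat P Q).d n m).hom (hatMk P Q n f) = hatMk P Q m (δ n m f) := rfl

/-- The cycle of `\widehat{Hom}_R(P, Q)` given by a cochain with bounded differential. -/
noncomputable def toCyclesHat :
    AddCommGrpCat.of (almostCocycles P Q n) ⟶ (homHat P Q).cycles n :=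
  (homHat P Q).liftCycles (A := AddCommGrpCat.of (almostCocycles P Q n))
    (AddCommGrpCat.ofHom ((hatMk P Q n).comp (almostCocycles P Q n).subtype)) (n + 1) (by simp) (by
        apply AddCommGrpCat.hom_ext
        refine AddMonoidHom.ext fun f => ?_
        exact hatMk_eq_zero_iff.2 f.2)

lemma iCycles_toCyclesHat (f : almostCocycles P Q n) :
    ((homHat P Q).iCycles n).hom ((toCyclesHat P Q n).hom f) =
      hatMk P Q n f.1 := by
  have h := (homHat P Q).liftCycles_i (AddCommGrpCat.ofHom ((hatMk P Q n).comp
    (almostCocycles P Q n).subtype)) (n + 1) (by simp) (by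
        apply AddCommGrpCat.hom_ext
        refine AddMonoidHom.ext fun f => ?_
        exact hatMk_eq_zero_iff.2 f.2)
  exact DFunLike.congr_fun (congrArg AddCommGrpCat.Hom.hom h) f

/-- The class in `Hⁿ(\widehat{Hom}_R(P, Q))` of a cochain with bounded differential. -/
noncomputable def toHomologyHat : almostCocycles P Q n →+ (homHat P Q).homology n :=
  (toCyclesHat P Q n ≫ (homHat P Q).homologyπ n).hom

lemma toHomologyHat_surjective : Function.Surjective (toHomologyHat P Q n) := by
  intro x
  obtain ⟨y, rfl⟩ := homologyπ_surjective _ _ x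
  obtain ⟨f, hf⟩ := hatMk_surjective P Q n
    (((homHat P Q).iCycles n).hom y)
  have hf' : f ∈ almostCocycles P Q n := by
    refine hatMk_eq_zero_iff.1 ((d_hatMk P Q n (n + 1) f).symm.trans ?_)
    rw [hf]
    exact DFunLike.congr_fun (congrArg AddCommGrpCat.Hom.hom ((homHat P Q).iCycles_d n (n + 1))) y
  refine ⟨⟨f, hf'⟩, ?_⟩
  refine congrArg ((homHat P Q).homologyπ n).hom (iCycles_injective _ _ ?_)
  exact (iCycles_toCyclesHat P Q n ⟨f, hf'⟩).trans hf

/-- Boundaries of the quotient complex lift to coboundaries of the Hom-complex, with an error that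
is a bounded cochain. -/
lemma toHomologyHat_eq_zero_iff (f : almostCocycles P Q n) :
    toHomologyHat P Q n f = 0 ↔
      ∃ h : Cochain P Q (n - 1), f.1 - δ (n - 1) n h ∈ boundedCochains P Q n := by
  have key (h : Cochain P Q (n - 1)) :
      (((homHat P Q).toCycles (n - 1) n).hom (hatMk P Q (n - 1) h) =
        (toCyclesHat P Q n).hom f) ↔ f.1 - δ (n - 1) n h ∈ boundedCochains P Q n := by
    have e : ((homHat P Q).iCycles n).hom (((homHat P Q).toCycles (n - 1) n).hom
        (hatMk P Q (n - 1) h)) = hatMk P Q n (δ (n - 1) n h) :=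
      DFunLike.congr_fun (congrArg AddCommGrpCat.Hom.hom ((homHat P Q).toCycles_i (n - 1) n)) _
    rw [← (iCycles_injective _ _).eq_iff, iCycles_toCyclesHat, e, ← hatMk_eq_zero_iff, map_sub,
      sub_eq_zero, eq_comm]
  constructor
  · intro hf
    obtain ⟨x, hx⟩ := exists_toCycles_of_homologyπ_eq_zero _ (n - 1) n (by lia) _ hf
    obtain ⟨h, rfl⟩ := hatMk_surjective P Q _ x
    exact ⟨h, (key h).1 hx⟩
  · rintro ⟨h, hh⟩
    have e := (key h).2 hh
    refine (congrArg ((homHat P Q).homologyπ n).hom e).symm.trans ?_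
    exact DFunLike.congr_fun (congrArg AddCommGrpCat.Hom.hom
      ((homHat P Q).toCycles_comp_homologyπ (n - 1) n)) (hatMk P Q (n - 1) h)

variable {P Q n}

lemma cocycle_mem_almostCocycles (z : Cocycle P Q n) : z.1 ∈ almostCocycles P Q n := by
  change δ n (n + 1) z.1 ∈ boundedCochains P Q (n + 1)
  rw [z.δ_eq_zero]
  exact zero_mem _

lemma homologyMap_toHomHat_mk (z : Cocycle P Q n) :
    (HomologicalComplex.homologyMap (toHomHat P Q) n).hom
      ((homologyAddEquiv P Q n).symm (CohomologyClass.mk z)) =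
        toHomologyHat P Q n ⟨z.1, cocycle_mem_almostCocycles z⟩ := by
  let c : (HomComplex P Q).cycles n := (leftHomologyData P Q n).cyclesIso.inv.hom z
  have hc : ((HomComplex P Q).iCycles n).hom c = z.1 :=
    congr($((leftHomologyData P Q n).cyclesIso_inv_comp_iCycles).hom z)
  have e : (homologyAddEquiv P Q n).symm (CohomologyClass.mk z) =
      ((HomComplex P Q).homologyπ n).hom c :=
    congr($((leftHomologyData P Q n).π_comp_homologyIso_inv).hom z)
  rw [e]
  refine (congr($(HomologicalComplex.homologyπ_naturality (toHomHat P Q) n).hom c)).trans ?_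
  refine congrArg ((homHat P Q).homologyπ n).hom (iCycles_injective _ _ ?_)
  refine (congr($(HomologicalComplex.cyclesMap_i (toHomHat P Q) n).hom c)).trans ?_
  refine Eq.trans ?_ (iCycles_toCyclesHat P Q n ⟨z.1, cocycle_mem_almostCocycles z⟩).symm
  exact congrArg (hatMk P Q n) hc

end HomologyHat

namespace KMinusB

open CochainComplex CochainComplex.HomComplex

variable {R : Type u} [Ring R]

/-! ### Cocycles as morphisms `P ⟶ Σⁿ Q`, and their naturality. -/

section Classes

/-- The morphism in `K^{-,b}(R-proj)` given by a morphism of complexes. -/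
noncomputable def ofChainMap {P Q : KMinusB R} (φ : P.complex ⟶ Q.complex) : P ⟶ Q :=
  ObjectProperty.homMk ((HomotopyCategory.quotient (FGProj R) (.up ℤ)).map φ)

lemma ofChainMap_comp {P Q L : KMinusB R} (φ : P.complex ⟶ Q.complex) (ψ : Q.complex ⟶ L.complex) :
    ofChainMap (φ ≫ ψ) = ofChainMap φ ≫ ofChainMap ψ := by
  apply ObjectProperty.hom_ext
  exact (HomotopyCategory.quotient (FGProj R) (.up ℤ)).map_comp φ ψ

lemma ofChainMap_surjective {P Q : KMinusB R} (f : P ⟶ Q) :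
    ∃ φ : P.complex ⟶ Q.complex, ofChainMap φ = f := by
  obtain ⟨φ, hφ⟩ := (HomotopyCategory.quotient (FGProj R) (.up ℤ)).map_surjective
    (X := P.complex) (Y := Q.complex) f.hom
  exact ⟨φ, ObjectProperty.hom_ext _ hφ⟩

variable (P Q : KMinusB R) (n : ℤ)

/-- The morphism `P ⟶ Σⁿ Q` in `K^{-,b}(R-proj)` given by a cocycle of degree `n`. -/
noncomputable def shiftedHomMk : Cocycle P.complex Q.complex n →+ ShiftedHom P Q n :=
  (homotopyClassEquiv P Q n).toAddMonoidHom.comp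
    (CohomologyClass.toHom.comp (CohomologyClass.mkAddMonoidHom P.complex Q.complex n))

variable {P Q n}

lemma homologyHomEquiv_mk (z : Cocycle P.complex Q.complex n) :
    homologyHomEquiv P Q n ((homologyAddEquiv P.complex Q.complex n).symm (CohomologyClass.mk z)) =
      shiftedHomMk P Q n z := by
  simp only [homologyHomEquiv, AddEquiv.trans_apply, AddEquiv.apply_symm_apply]
  rfl

lemma shiftedHomMk_surjective : Function.Surjective (shiftedHomMk P Q n) :=
  (homotopyClassEquiv P Q n).surjective.comp
    ((CohomologyClass.toHom_bijective _ _ _).2.comp CohomologyClass.mk_surjective)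

lemma shiftedHomMk_eq_zero_iff (z : Cocycle P.complex Q.complex n) :
    shiftedHomMk P Q n z = 0 ↔ ∃ h : Cochain P.complex Q.complex (n - 1), δ (n - 1) n h = z.1 := by
  refine ((homotopyClassEquiv P Q n).map_eq_zero_iff).trans ?_
  refine (CohomologyClass.toHom_mk_eq_zero_iff z).trans ?_
  exact mem_coboundaries_iff z (n - 1) (by lia)

lemma homotopyClassEquiv_hom (x : (HomotopyCategory.quotient (FGProj R) (.up ℤ)).obj P.complex ⟶
      (HomotopyCategory.quotient (FGProj R) (.up ℤ)).obj (Q.complex⟦n⟧)) :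
    (homotopyClassEquiv P Q n x).hom =
      x ≫ ((HomotopyCategory.quotient (FGProj R) (.up ℤ)).commShiftIso n).hom.app Q.complex ≫
        ((boundedAboveWithBoundedCohomology R).ι.commShiftIso n).inv.app Q := rfl

/-- Pasting of squares for `shiftedHomMk_comp`, where they are the naturality of the two shift
comparison isomorphisms. -/
lemma comp_comp_comp_eq_of_squares {C : Type*} [Category* C] {X Y Y' Z Z' W W' : C}
    {x : X ⟶ Y} {x' : X ⟶ Y'} {a : Y ⟶ Z} {b : Z ⟶ W} {c : W ⟶ W'} {a' : Y' ⟶ Z'} {b' : Z' ⟶ W'}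
    {d : Z ⟶ Z'} {e : Y ⟶ Y'} (h₁ : d ≫ b' = b ≫ c) (h₂ : e ≫ a' = a ≫ d) (h₃ : x ≫ e = x') :
    (x ≫ a ≫ b) ≫ c = x' ≫ a' ≫ b' := by
  simp only [Category.assoc, ← h₁, ← h₃, reassoc_of% h₂]

lemma shiftedHomMk_comp {L : KMinusB R} (z : Cocycle P.complex Q.complex n)
    (φ : Q.complex ⟶ L.complex) :
    shiftedHomMk P Q n z ≫ (ofChainMap φ)⟦n⟧' = shiftedHomMk P L n (z.postcomp φ) := by
  apply ObjectProperty.hom_ext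
  have h₁ := (boundedAboveWithBoundedCohomology R).ι.commShiftIso_inv_naturality (ofChainMap φ) n
  have h₂ := (HomotopyCategory.quotient (FGProj R) (.up ℤ)).commShiftIso_hom_naturality φ n
  change (homotopyClassEquiv P Q n _).hom ≫ (boundedAboveWithBoundedCohomology R).ι.map _ =
    (homotopyClassEquiv P L n _).hom
  rw [homotopyClassEquiv_hom, homotopyClassEquiv_hom]
  refine comp_comp_comp_eq_of_squares h₁ h₂ ?_
  change CohomologyClass.toHom (CohomologyClass.mk z) ≫ _ =
    CohomologyClass.toHom (CohomologyClass.mk (z.postcomp φ))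
  rw [CohomologyClass.toHom_mk, CohomologyClass.toHom_mk, Cocycle.equivHomShift_symm_postcomp,
    Functor.map_comp]

lemma comp_shiftedHomMk {L : KMinusB R} (φ : L.complex ⟶ P.complex)
    (z : Cocycle P.complex Q.complex n) :
    ofChainMap φ ≫ shiftedHomMk P Q n z = shiftedHomMk L Q n (z.precomp φ) := by
  apply ObjectProperty.hom_ext
  change (HomotopyCategory.quotient (FGProj R) (.up ℤ)).map φ ≫ (homotopyClassEquiv P Q n _).hom =
    (homotopyClassEquiv L Q n _).hom
  rw [homotopyClassEquiv_hom, homotopyClassEquiv_hom, ← Category.assoc]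
  congr 1
  change _ ≫ CohomologyClass.toHom (CohomologyClass.mk z) =
    CohomologyClass.toHom (CohomologyClass.mk (z.precomp φ))
  rw [CohomologyClass.toHom_mk, CohomologyClass.toHom_mk, Cocycle.equivHomShift_symm_precomp,
    Functor.map_comp]

lemma quotientMap_comp {L : KMinusB R} (x : ShiftedHom P Q n) (f : Q ⟶ L) :
    quotientMap P L n (x ≫ f⟦n⟧') = quotientMap P Q n x ≫ ((quotientFunctor R).map f)⟦n⟧' := by
  change (quotientFunctor R).map (x ≫ f⟦n⟧') ≫ _ = ((quotientFunctor R).map x ≫ _) ≫ _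
  rw [Functor.map_comp, Category.assoc, Category.assoc]
  congr 1
  exact (quotientFunctor R).commShiftIso_hom_naturality f n

end Classes

/-! ### Morphisms that factor through bounded complexes. -/

section Bounded

/-- Replaces an object merely isomorphic to a bounded complex by one whose terms actually vanish, as
arguments with cochains require. -/
lemma exists_iso_bounded {B : KMinusB R} (hB : homotopyBounded R B) :
    ∃ B' : KMinusB R, bounded R B'.obj ∧ Nonempty (B' ≅ B) := by
  obtain ⟨B', hB', ⟨e⟩⟩ := hB
  exact ⟨⟨B', hB'.1, bounded_le_boundedCohomology R _ hB'⟩, hB',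
    ⟨(boundedAboveWithBoundedCohomology R).fullyFaithfulι.preimageIso e.symm⟩⟩

lemma mem_boundedCochains_of_bounded {B Q : KMinusB R} (hB : bounded R B.obj) {n : ℤ}
    (w : Cochain B.complex Q.complex n) : w ∈ boundedCochains B.complex Q.complex n := by
  obtain ⟨⟨b, hb⟩, ⟨a, ha⟩⟩ := hB
  exact mem_boundedCochains_iff.2 ⟨a, b, fun p q hpq hp =>
    IsZero.eq_of_src (hp.elim (ha p) (hb p)) _ _⟩

variable {P Q B : KMinusB R} {n : ℤ}

/-- A cocycle whose class factors through a bounded complex is bounded up to a coboundary. -/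
lemma exists_sub_δ_mem_boundedCochains (hB : homotopyBounded R B)
    (z : Cocycle P.complex Q.complex n)
    (u : P ⟶ B) (v : B ⟶ Q⟦n⟧) (h : shiftedHomMk P Q n z = u ≫ v) :
    ∃ w : Cochain P.complex Q.complex (n - 1),
      z.1 - δ (n - 1) n w ∈ boundedCochains P.complex Q.complex n := by
  obtain ⟨B', hB', ⟨e⟩⟩ := exists_iso_bounded hB
  obtain ⟨φ, hφ⟩ := ofChainMap_surjective (u ≫ e.inv)
  obtain ⟨w, hw⟩ := shiftedHomMk_surjective (P := B') (Q := Q) (n := n) (e.hom ≫ v)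
  -- Up to a coboundary, `z` is the composite of a chain map to `B'` with a cocycle out of `B'`, and
  -- the latter is automatically bounded.
  have h' : shiftedHomMk P Q n (z - w.precomp φ) = 0 := by
    rw [map_sub, sub_eq_zero, h, ← comp_shiftedHomMk, hφ, hw]
    simp
  obtain ⟨k, hk⟩ := (shiftedHomMk_eq_zero_iff _).1 h'
  refine ⟨k, ?_⟩
  have hk' : z.1 - δ (n - 1) n k = (w.precomp φ).1 := by
    rw [hk]
    exact sub_sub_cancel _ _
  rw [hk']
  exact comp_mem_boundedCochains_right _ (mem_boundedCochains_of_bounded hB' w.1) (zero_add n)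

/-- A cocycle out of a bounded complex reaches only finitely many degrees of `Q`, and `π_m` kills
these for small `m`. -/
lemma exists_comp_toTrunc_eq_zero (hB : homotopyBounded R B) (v : B ⟶ Q⟦n⟧) :
    ∃ m : ℤ, v ≫ (Q.toTrunc m)⟦n⟧' = 0 := by
  obtain ⟨B', hB', ⟨e⟩⟩ := exists_iso_bounded hB
  obtain ⟨w, hw⟩ := shiftedHomMk_surjective (P := B') (Q := Q) (n := n) (e.hom ≫ v)
  obtain ⟨m, hm⟩ := exists_comp_truncHom_eq_zero (mem_boundedCochains_of_bounded hB' w.1)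
  refine ⟨m, ?_⟩
  rw [← cancel_epi e.hom, ← Category.assoc, ← hw, comp_zero]
  refine (shiftedHomMk_comp w (Q.truncHom m)).trans ?_
  have h : w.postcomp (Q.truncHom m) = 0 := Cocycle.ext (hm m le_rfl)
  rw [h, map_zero]

end Bounded

/-! ### Comparison of the quotient complex with the singularity category. -/

section Comparison

variable (P Q : KMinusB R)

lemma trunc_d (m i j : ℤ) : (Q.trunc m).complex.d i j =
    Q.truncIn m i ≫ Q.complex.d i j ≫ (Q.truncHom m).f j := rfl

lemma truncHom_truncIn_truncHom {m m' : ℤ} (h : m' ≤ m) (i : ℤ) :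
    (Q.truncHom m).f i ≫ Q.truncIn m i ≫ (Q.truncHom m').f i = (Q.truncHom m').f i := by
  by_cases hi : i < m'
  · exact brutePr_bruteIn_assoc Q.complex (Set.Iio m) (show i < m by lia) _
  · simp [Q.truncHom_f_eq_zero (show m' ≤ i by lia)]

/-- The transition morphisms between the brutal truncations. -/
noncomputable def truncTransition {m m' : ℤ} (h : m' ≤ m) :
    (Q.trunc m).complex ⟶ (Q.trunc m').complex where
  f i := Q.truncIn m i ≫ (Q.truncHom m').f i
  comm' i j _ := by
    rw [Q.trunc_d m i j, Category.assoc, Category.assoc, Category.assoc,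
      Q.truncHom_truncIn_truncHom h, (Q.truncHom m').comm]

lemma truncHom_transition {m m' : ℤ} (h : m' ≤ m) :
    Q.truncHom m ≫ Q.truncTransition h = Q.truncHom m' := by
  ext i : 1
  exact Q.truncHom_truncIn_truncHom h i

instance isIso_quotientFunctor_map_toTrunc (m : ℤ) :
    IsIso ((quotientFunctor R).map (Q.toTrunc m)) :=
  Localization.inverts (quotientFunctor R) (homotopyBounded R).trW _ (Q.toTrunc_mem_trW m)

variable {P Q} {n : ℤ}

/-- The image of a cochain in the cochains with values in a truncation, when it is a cocycle. -/
noncomputable def truncCocycle (f : Cochain P.complex Q.complex n) (m : ℤ)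
    (h : (δ n (n + 1) f).comp (Cochain.ofHom (Q.truncHom m)) (add_zero _) = 0) :
    Cocycle P.complex (Q.trunc m).complex n :=
  Cocycle.mk (f.comp (Cochain.ofHom (Q.truncHom m)) (add_zero n)) (n + 1) rfl (by
    rw [δ_comp_ofHom, h])

/-- The relation between a cochain `f` with bounded differential and the morphism
`P ⟶ Σⁿ Q` in the singularity category that it represents. -/
def Represents (f : Cochain P.complex Q.complex n)
    (g : ShiftedHom ((quotientFunctor R).obj P) ((quotientFunctor R).obj Q) n) : Prop :=
  ∃ (m₀ : ℤ), ∀ m ≤ m₀,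
    ∃ h : (δ n (n + 1) f).comp (Cochain.ofHom (Q.truncHom m)) (add_zero _) = 0,
      g ≫ ((quotientFunctor R).map (Q.toTrunc m))⟦n⟧' =
        quotientMap P (Q.trunc m) n (shiftedHomMk _ _ n (truncCocycle f m h))

/-- One truncation suffices: the transition morphisms carry the equation at `m` to every smaller
index. The definition asks for all small `m` so that two representations can be compared at a common
one. -/
lemma represents_of_eq {f : Cochain P.complex Q.complex n}
    {g : ShiftedHom ((quotientFunctor R).obj P) ((quotientFunctor R).obj Q) n} (m : ℤ)
    (h : (δ n (n + 1) f).comp (Cochain.ofHom (Q.truncHom m)) (add_zero _) = 0)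
    (hg : g ≫ ((quotientFunctor R).map (Q.toTrunc m))⟦n⟧' =
        quotientMap P (Q.trunc m) n (shiftedHomMk _ _ n (truncCocycle f m h))) :
    Represents f g := by
  refine ⟨m, fun m' hm' => ?_⟩
  have e : Q.toTrunc m' = Q.toTrunc m ≫ ofChainMap (Q.truncTransition hm') := by
    refine Eq.trans ?_ (ofChainMap_comp _ _)
    rw [truncHom_transition]
    rfl
  have h' : (δ n (n + 1) f).comp (Cochain.ofHom (Q.truncHom m')) (add_zero _) = 0 := by
    rw [← Q.truncHom_transition hm', Cochain.ofHom_comp,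
      ← Cochain.comp_assoc_of_third_is_zero_cochain, h, Cochain.zero_comp]
  refine ⟨h', ?_⟩
  rw [e, Functor.map_comp, Functor.map_comp, ← Category.assoc, hg, ← quotientMap_comp,
    shiftedHomMk_comp]
  congr 2
  apply Cocycle.ext
  change (f.comp _ (add_zero n)).comp _ (add_zero n) = f.comp _ (add_zero n)
  rw [Cochain.comp_assoc_of_third_is_zero_cochain, ← Cochain.ofHom_comp, truncHom_transition]

/-- At a common truncation both morphisms have the same composite with an isomorphism of `D_sg`. -/
lemma Represents.unique {f : Cochain P.complex Q.complex n}
    {g g' : ShiftedHom ((quotientFunctor R).obj P) ((quotientFunctor R).obj Q) n}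
    (h : Represents f g) (h' : Represents f g') : g = g' := by
  obtain ⟨m, hm⟩ := h
  obtain ⟨m', hm'⟩ := h'
  obtain ⟨_, h₁⟩ := hm (min m m') (by simp)
  obtain ⟨_, h₂⟩ := hm' (min m m') (by simp)
  exact (cancel_mono (((quotientFunctor R).map (Q.toTrunc (min m m')))⟦n⟧')).1 (h₁.trans h₂.symm)

lemma Represents.add {f f' : Cochain P.complex Q.complex n}
    {g g' : ShiftedHom ((quotientFunctor R).obj P) ((quotientFunctor R).obj Q) n}
    (h : Represents f g) (h' : Represents f' g') : Represents (f + f') (g + g') := by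
  obtain ⟨m, hm⟩ := h
  obtain ⟨m', hm'⟩ := h'
  obtain ⟨h₁, e₁⟩ := hm (min m m') (by simp)
  obtain ⟨h₂, e₂⟩ := hm' (min m m') (by simp)
  have h₃ : (δ n (n + 1) (f + f')).comp (Cochain.ofHom (Q.truncHom (min m m')))
      (add_zero _) = 0 := by
    rw [δ_add, Cochain.add_comp, h₁, h₂, add_zero]
  refine represents_of_eq (min m m') h₃ ?_
  refine (Preadditive.add_comp _ _ _ g g' _).trans ?_
  rw [e₁, e₂, ← map_add, ← map_add]
  congr 2
  exact Cocycle.ext (Cochain.add_comp f f' _ (add_zero n)).symm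

lemma exists_represents {f : Cochain P.complex Q.complex n}
    (hf : f ∈ almostCocycles P.complex Q.complex n) :
    ∃ g : ShiftedHom ((quotientFunctor R).obj P) ((quotientFunctor R).obj Q) n,
      Represents f g := by
  obtain ⟨m, hm⟩ := exists_comp_truncHom_eq_zero (P := P) (Q := Q) hf
  exact ⟨quotientMap P (Q.trunc m) n (shiftedHomMk _ _ n (truncCocycle f m (hm m le_rfl))) ≫
    inv (((quotientFunctor R).map (Q.toTrunc m))⟦n⟧'), represents_of_eq m (hm m le_rfl) (by simp)⟩

lemma represents_cocycle (z : Cocycle P.complex Q.complex n) :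
    Represents z.1 (quotientMap P Q n (shiftedHomMk P Q n z)) := by
  -- Any truncation index would do, since `z` is a cocycle before truncation; `0` is arbitrary.
  have h : (δ n (n + 1) z.1).comp (Cochain.ofHom (Q.truncHom 0)) (add_zero _) = 0 := by
    rw [z.δ_eq_zero, Cochain.zero_comp]
  refine represents_of_eq 0 h ?_
  rw [← quotientMap_comp]
  exact congrArg _ (shiftedHomMk_comp z (Q.truncHom 0))

/-- This identifies the kernel of the comparison with that of the passage to cohomology, and hence
gives injectivity. -/
lemma represents_zero_iff {f : Cochain P.complex Q.complex n}
    (hf : f ∈ almostCocycles P.complex Q.complex n) :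
    Represents f 0 ↔ ∃ k : Cochain P.complex Q.complex (n - 1),
      f - δ (n - 1) n k ∈ boundedCochains P.complex Q.complex n := by
  constructor
  · rintro ⟨m, hm⟩
    obtain ⟨h, e⟩ := hm m le_rfl
    rw [zero_comp] at e
    have e' : (quotientFunctor R).map (shiftedHomMk _ _ n (truncCocycle f m h)) =
        (quotientFunctor R).map 0 := by
      rw [Functor.map_zero]
      exact (cancel_mono (((quotientFunctor R).commShiftIso n).hom.app (Q.trunc m))).1
        (e.symm.trans zero_comp.symm)
    -- Vanishing in the localization means vanishing after some `s` with bounded fibre `B`, so the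
    -- class of `f π_m` factors through `B`.
    obtain ⟨Z, s, hs, hz⟩ := (MorphismProperty.map_eq_iff_postcomp (quotientFunctor R)
      (homotopyBounded R).trW _ _).1 e'
    obtain ⟨B, v, _, hT, hB⟩ := ((homotopyBounded R).trW_iff' s).1 hs
    rw [zero_comp] at hz
    obtain ⟨w, hw⟩ := Pretriangulated.Triangle.coyoneda_exact₂ _ hT _ hz
    obtain ⟨k, hk⟩ := exists_sub_δ_mem_boundedCochains hB _ w v hw
    refine ⟨k.comp (Q.truncSection m) (add_zero _), ?_⟩
    have h₁ := comp_mem_boundedCochains_left hk (Q.truncSection m) (add_zero n)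
    have h₂ := sub_comp_truncSection_mem P Q f m
    have h₃ := comp_mem_boundedCochains_right k (Q.δ_truncSection_mem m)
      (show n - 1 + 1 = n by lia)
    -- With `s` now the section, `f - δ(k s) = (f π_m - δ k) s + (f - f π_m s) - k δ s`, and each of
    -- the three terms is bounded.
    convert sub_mem (add_mem h₁ h₂) h₃ using 1
    rw [δ_comp_zero_cochain k (Q.truncSection m) n (by lia), Cochain.sub_comp]
    change _ = (f.comp _ (add_zero n)).comp _ (add_zero n) - _ + _ - _
    abel
  · rintro ⟨k, hk⟩
    obtain ⟨m₁, hm₁⟩ := exists_comp_truncHom_eq_zero hk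
    obtain ⟨m₂, hm₂⟩ := exists_comp_truncHom_eq_zero (P := P) (Q := Q) hf
    let m := min m₁ m₂
    refine represents_of_eq m (hm₂ m (by simp [m])) ?_
    rw [zero_comp, (shiftedHomMk_eq_zero_iff _).2, map_zero]
    refine ⟨k.comp (Cochain.ofHom (Q.truncHom m)) (add_zero _), ?_⟩
    have h := hm₁ m (by simp [m])
    rw [Cochain.sub_comp, sub_eq_zero] at h
    rw [δ_comp_ofHom]
    exact h.symm

lemma exists_almostCocycle
    (g : ShiftedHom ((quotientFunctor R).obj P) ((quotientFunctor R).obj Q) n) :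
    ∃ f ∈ almostCocycles P.complex Q.complex n, Represents f g := by
  -- The shift is first moved inside the quotient functor, so that fractions from `P` to `Q⟦n⟧`
  -- apply.
  obtain ⟨φ, hφ⟩ := Localization.exists_leftFraction (quotientFunctor R)
    (homotopyBounded R).trW (g ≫ ((quotientFunctor R).commShiftIso n).inv.app Q)
  have hφ' := φ.map_comp_map_s (quotientFunctor R) (Localization.inverts _ _)
  rw [← hφ] at hφ'
  obtain ⟨B, v, _, hT, hB⟩ := ((homotopyBounded R).trW_iff' φ.s).1 φ.hs
  obtain ⟨m, hm⟩ := exists_comp_toTrunc_eq_zero hB v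
  -- The fibre `B` of the denominator is killed by `π_m`, so `π_m` extends along the denominator;
  -- the fraction followed by `π_m` is then the honest morphism `φ.f ≫ t`.
  obtain ⟨t, ht⟩ : ∃ t : φ.Y' ⟶ (Q.trunc m)⟦n⟧, (Q.toTrunc m)⟦n⟧' = φ.s ≫ t :=
    Pretriangulated.Triangle.yoneda_exact₂ _ hT _ hm
  obtain ⟨w, hw⟩ := shiftedHomMk_surjective (P := P) (Q := Q.trunc m) (n := n) (φ.f ≫ t)
  -- Lifting the cocycle `w` along the degreewise section leaves only the differential of the
  -- section in `δ f`, and that is bounded.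
  let f := w.1.comp (Q.truncSection m) (add_zero n)
  have hδ : δ n (n + 1) f = w.1.comp (δ 0 1 (Q.truncSection m)) rfl := by
    rw [δ_comp_zero_cochain _ _ (n + 1) rfl, w.δ_eq_zero, Cochain.zero_comp, add_zero]
  have hf : f ∈ almostCocycles P.complex Q.complex n := by
    change δ n (n + 1) f ∈ boundedCochains P.complex Q.complex (n + 1)
    rw [hδ]
    exact comp_mem_boundedCochains_right _ (Q.δ_truncSection_mem m) _
  have hfw : f.comp (Cochain.ofHom (Q.truncHom m)) (add_zero n) = w.1 := by
    rw [Cochain.comp_assoc_of_third_is_zero_cochain, truncSection_comp, Cochain.comp_id]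
  have h : (δ n (n + 1) f).comp (Cochain.ofHom (Q.truncHom m)) (add_zero _) = 0 := by
    rw [← δ_comp_ofHom, hfw, w.δ_eq_zero]
  refine ⟨f, hf, represents_of_eq m h ?_⟩
  have hw' : truncCocycle f m h = w := Cocycle.ext hfw
  rw [hw', hw]
  have e := (quotientFunctor R).commShiftIso_inv_naturality (Q.toTrunc m) n
  rw [← cancel_mono (((quotientFunctor R).commShiftIso n).inv.app (Q.trunc m))]
  change _ = ((quotientFunctor R).map (φ.f ≫ t) ≫ ((quotientFunctor R).commShiftIso n).hom.app _) ≫ _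
  rw [Category.assoc, Category.assoc, e, ht, Functor.map_comp, Functor.map_comp, ← Category.assoc,
    ← Category.assoc, hφ', Iso.hom_inv_id_app]
  exact (Category.comp_id _).symm

variable (P Q n)

/-- The morphism in the singularity category represented by a cochain with bounded differential. -/
noncomputable def singularityClass : almostCocycles P.complex Q.complex n →+
    ShiftedHom ((quotientFunctor R).obj P) ((quotientFunctor R).obj Q) n :=
  AddMonoidHom.mk' (fun f => (exists_represents f.2).choose) (fun f f' =>
    (exists_represents (f + f').2).choose_spec.unique
      ((exists_represents f.2).choose_spec.add (exists_represents f'.2).choose_spec))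

variable {P Q n}

lemma singularityClass_eq_iff (f : almostCocycles P.complex Q.complex n)
    (g : ShiftedHom ((quotientFunctor R).obj P) ((quotientFunctor R).obj Q) n) :
    singularityClass P Q n f = g ↔ Represents f.1 g :=
  ⟨by rintro rfl; exact (exists_represents f.2).choose_spec,
    fun h => (exists_represents f.2).choose_spec.unique h⟩

lemma singularityClass_surjective : Function.Surjective (singularityClass P Q n) := by
  intro g
  obtain ⟨f, hf, h⟩ := exists_almostCocycle g
  exact ⟨⟨f, hf⟩, (singularityClass_eq_iff _ _).2 h⟩

/-- Both kernels consist of the cochains that are bounded up to a coboundary. -/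
lemma ker_toHomologyHat :
    (toHomologyHat P.complex Q.complex n).ker = (singularityClass P Q n).ker := by
  ext f
  rw [AddMonoidHom.mem_ker, AddMonoidHom.mem_ker, toHomologyHat_eq_zero_iff,
    singularityClass_eq_iff, represents_zero_iff f.2]

variable (P Q n)

/-- The isomorphism `Hⁿ(\widehat{Hom}_R(P, Q)) ≃ Hom_{D_sg(R)}(P, Σⁿ Q)`. -/
noncomputable def homologyHatEquiv : (homHat P.complex Q.complex).homology n ≃+
    ShiftedHom ((quotientFunctor R).obj P) ((quotientFunctor R).obj Q) n :=
  ((QuotientAddGroup.quotientKerEquivOfSurjective _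
      (toHomologyHat_surjective P.complex Q.complex n)).symm.trans
    (QuotientAddGroup.quotientAddEquivOfEq ker_toHomologyHat)).trans
      (QuotientAddGroup.quotientKerEquivOfSurjective _ singularityClass_surjective)

variable {P Q n}

lemma homologyHatEquiv_toHomologyHat (f : almostCocycles P.complex Q.complex n) :
    homologyHatEquiv P Q n (toHomologyHat P.complex Q.complex n f) = singularityClass P Q n f := by
  have h : (QuotientAddGroup.quotientKerEquivOfSurjective _
      (toHomologyHat_surjective P.complex Q.complex n)).symm
        (toHomologyHat P.complex Q.complex n f) = (f : _ ⧸ _) := by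
    rw [AddEquiv.symm_apply_eq]
    rfl
  rw [homologyHatEquiv, AddEquiv.trans_apply, AddEquiv.trans_apply, h]
  rfl

/-- A cocycle represents the image of its own class, so the projection corresponds to the quotient
functor. -/
lemma homologyHatEquiv_homologyMap (x : (HomComplex P.complex Q.complex).homology n) :
    homologyHatEquiv P Q n
      ((HomologicalComplex.homologyMap (toHomHat P.complex Q.complex) n).hom x) =
        quotientMap P Q n (homologyHomEquiv P Q n x) := by
  obtain ⟨y, rfl⟩ := (homologyAddEquiv P.complex Q.complex n).symm.surjective x
  obtain ⟨z, rfl⟩ := CohomologyClass.mk_surjective y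
  rw [homologyMap_toHomHat_mk, homologyHatEquiv_toHomologyHat, homologyHomEquiv_mk,
    singularityClass_eq_iff]
  exact represents_cocycle z

end Comparison

end KMinusB

/-! ### Homomorphisms out of finitely generated projectives as tensors. -/

section RankOne

variable {R : Type u} [Ring R]

/-- `M` is a retract of some `R^k`: take the coordinates of the section and the images of the
standard basis under the retraction. -/
lemma exists_dual_basis (M : Type u) [AddCommGroup M] [Module R M] [Module.Finite R M]
    [Module.Projective R M] :
    ∃ (k : ℕ) (φ : Fin k → M →ₗ[R] R) (e : Fin k → M), ∀ m, ∑ i, φ i m • e i = m := by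
  obtain ⟨k, f, g, -, -, hfg⟩ := Module.Finite.exists_comp_eq_id_of_projective R M
  refine ⟨k, fun i => (LinearMap.proj i).comp g, fun i => f (Pi.single i 1), fun m => ?_⟩
  have h : f (g m) = m := LinearMap.congr_fun hfg m
  conv_rhs => rw [← h, ← Finset.univ_sum_single (g m), map_sum]
  refine Finset.sum_congr rfl (fun i _ => ?_)
  rw [← map_smul, ← Pi.single_smul, smul_eq_mul, mul_one]
  rfl

variable (M N : FGProj R)

/-- The map `Hom_R(M, R) ⊗_R N → Hom_R(M, N)`. -/
def rankOneHom : BalancedTensor R (M.obj →ₗ[R] R) N.obj →+ (M ⟶ N) :=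
  BalancedTensor.lift (R := R)
    (AddMonoidHom.mk' (fun f => AddMonoidHom.mk' (fun x => rankOne f x) (rankOne_add_right f))
      (fun f g => AddMonoidHom.ext (rankOne_add_left f g)))
    (fun f r x => rankOne_smul f r x)

/-- The inverse is `g ↦ ∑ φ i ⊗ g (e i)` for a dual basis of `M`; nothing is needed of `N`. -/
lemma rankOneHom_bijective : Function.Bijective (rankOneHom M N) := by
  obtain ⟨hM₁, hM₂⟩ := M.property
  obtain ⟨k, φ, e, h⟩ := exists_dual_basis (R := R) M.obj
  let ψ : (M ⟶ N) →+ BalancedTensor R (M.obj →ₗ[R] R) N.obj :=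
    ∑ i, AddMonoidHom.mk' (fun g => BalancedTensor.tmul R (φ i) (g.hom.hom (e i)))
      (fun g g' => BalancedTensor.tmul_add _ _ _)
  have hψ (g : M ⟶ N) : ψ g = ∑ i, BalancedTensor.tmul R (φ i) (g.hom.hom (e i)) := by
    rw [AddMonoidHom.finsetSum_apply]
    rfl
  refine Function.bijective_iff_has_inverse.2 ⟨ψ, fun t => ?_, fun g => ?_⟩
  · have h' : ψ.comp (rankOneHom M N) = AddMonoidHom.id _ := by
      refine BalancedTensor.hom_ext (fun f x => ?_)
      refine (hψ (rankOne f x)).trans ?_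
      -- Moving the scalar `f (e i)` across the tensor sign leaves `∑ φ i · f (e i)` in the left
      -- factor, which is `f` by the dual basis.
      have h₁ (i : Fin k) : BalancedTensor.tmul R (φ i) ((rankOne f x).hom.hom (e i)) =
          (BalancedTensor.tmulHom R (M.obj →ₗ[R] R) N.obj).flip x
            (MulOpposite.op (f (e i)) • φ i) :=
        (BalancedTensor.tmul_smul (φ i) (f (e i)) x).symm
      rw [Finset.sum_congr rfl (fun i _ => h₁ i), ← map_sum]
      refine congrArg (fun f' => BalancedTensor.tmul R f' x) (LinearMap.ext fun m => ?_)
      conv_rhs => rw [← h m]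
      simp
    exact DFunLike.congr_fun h' t
  · rw [hψ, map_sum]
    have h₂ : (∑ i, (rankOne (φ i) (g.hom.hom (e i)) : M ⟶ N)) = g := by
      apply ObjectProperty.hom_ext
      apply ModuleCat.hom_ext
      refine LinearMap.ext fun m => ?_
      let ev : (M ⟶ N) →+ N.obj := AddMonoidHom.mk' (fun g => g.hom.hom m) (fun _ _ => rfl)
      change ev (∑ i, rankOne (φ i) (g.hom.hom (e i))) = g.hom.hom m
      conv_rhs => rw [← h m]
      rw [map_sum, map_sum]
      exact Finset.sum_congr rfl (fun i _ => (map_smul g.hom.hom (φ i m) (e i)).symm)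
    exact h₂

/-- The isomorphism `Hom_R(M, R) ⊗_R N ≃ Hom_R(M, N)` for finitely generated projective
modules. -/
noncomputable def rankOneEquiv : BalancedTensor R (M.obj →ₗ[R] R) N.obj ≃+ (M ⟶ N) :=
  AddEquiv.ofBijective (rankOneHom M N) (rankOneHom_bijective M N)

lemma rankOneEquiv_symm_rankOne (f : M.obj →ₗ[R] R) (x : N.obj) :
    (rankOneEquiv M N).symm (rankOne f x) = BalancedTensor.tmul R f x := by
  rw [AddEquiv.symm_apply_eq]
  rfl

end RankOne

/-! ### Exactness of the sequence of Hom-complexes. -/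

section ShortExact

open CochainComplex CochainComplex.HomComplex

variable {R : Type u} [Ring R] (P Q : CochainComplex (FGProj R) ℤ)

lemma single_rankOneHom_mem_range {p q n : ℤ} (hpq : p + n = q) (f : P.X p ⟶ Q.X q) :
    (Cochain.single f n : Cochain P Q n) ∈ ((tensorToHom P Q).f n).hom.range := by
  obtain ⟨i, rfl⟩ : ∃ i, p = -i := ⟨-p, by simp⟩
  have hi : i + q = n := by lia
  obtain ⟨t, rfl⟩ := (rankOneHom_bijective _ _).2 f
  let a : BalancedTensor R ((P.X (-i)).obj →ₗ[R] R) (Q.X q).obj →+ Cochain P Q n :=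
    (AddMonoidHom.mk' (fun f => (Cochain.single f n : Cochain P Q n))
      (fun f g => single_add P Q f g n)).comp
      (rankOneHom _ _)
  let b : BalancedTensor R ((P.X (-i)).obj →ₗ[R] R) (Q.X q).obj →+ Cochain P Q n :=
    (tensorToHomX P Q i q n).hom
  have hab : b = (i * q).negOnePow • a := BalancedTensor.hom_ext (fun f x => rfl)
  have h : (tensorToHom P Q).f n ((HomologicalComplex.ιMapBifunctor (dual P) (underlying Q)
      (tensorBifunctor R) (ComplexShape.up ℤ) i q n hi) t) = b t :=
    DFunLike.congr_fun (congrArg AddCommGrpCat.Hom.hom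
      (HomologicalComplex.ι_mapBifunctorDesc (fun i j _ => tensorToHomX P Q i j n) i q hi)) t
  -- The sign of the canonical map squares to `1`, so it can be moved to the other side.
  have h' : (Cochain.single (rankOneHom _ _ t) n : Cochain P Q n) = (i * q).negOnePow • b t := by
    rw [hab]
    change a t = (i * q).negOnePow • ((i * q).negOnePow • a t)
    rw [smul_smul, Int.units_mul_self, one_smul]
  have hb : b t ∈ ((tensorToHom P Q).f n).hom.range := ⟨_, h⟩
  rw [h']
  exact AddSubgroup.zsmul_mem _ hb _

/-- A bounded cochain is the finite sum of its components, each of which comes from a tensor. -/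
lemma mem_range_of_mem_boundedCochains {n : ℤ} {z : Cochain P Q n}
    (hz : z ∈ boundedCochains P Q n) : z ∈ ((tensorToHom P Q).f n).hom.range := by
  have hfin : {p : ℤ | z.v p (p + n) rfl ≠ 0}.Finite := hz
  have h : z = ∑ p ∈ hfin.toFinset, (Cochain.single (z.v p (p + n) rfl) n : Cochain P Q n) := by
    refine Cochain.ext _ _ (fun p q hpq => ?_)
    let ev : Cochain P Q n →+ (P.X p ⟶ Q.X q) :=
      AddMonoidHom.mk' (fun w => w.v p q hpq) (fun _ _ => rfl)
    refine Eq.trans ?_ (map_sum ev (fun p => (Cochain.single (z.v p (p + n) rfl) n :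
      Cochain P Q n)) hfin.toFinset).symm
    subst hpq
    by_cases hp : z.v p (p + n) rfl = 0
    · refine Eq.trans hp (Finset.sum_eq_zero (fun p' hp' => ?_)).symm
      refine Cochain.single_v_eq_zero _ n p (p + n) rfl ?_
      rintro rfl
      exact (Set.Finite.mem_toFinset _).1 hp' hp
    · rw [Finset.sum_eq_single p]
      · exact (Cochain.single_v (z.v p (p + n) rfl) n rfl).symm
      · intro p' _ hp'
        exact Cochain.single_v_eq_zero _ n p (p + n) rfl hp'.symm
      · intro hp'
        exact (hp' ((Set.Finite.mem_toFinset _).2 hp)).elim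
  rw [h]
  exact sum_mem (fun p _ => single_rankOneHom_mem_range P Q rfl _)

lemma tensorToHom_mem_boundedCochains (n : ℤ) (x : (tensorComplex R (dual P) (underlying Q)).X n) :
    ((tensorToHom P Q).f n).hom x ∈ boundedCochains P Q n := by
  refine hatMk_eq_zero_iff.1 ?_
  exact DFunLike.congr_fun (congrArg AddCommGrpCat.Hom.hom
    (HomologicalComplex.congr_hom (tensorToHom_comp_toHomHat P Q) n)) x

/-- The tensor in `(P*)ⁱ ⊗_R Q^{n - i}` corresponding to the component of a cochain of degree `n`
in degree `-i`. -/
noncomputable def tensorComponent (n i : ℤ) :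
    Cochain P Q n →+ (tensorComplex R (dual P) (underlying Q)).X n :=
  (HomologicalComplex.ιMapBifunctor (dual P) (underlying Q)
      (tensorBifunctor R) (ComplexShape.up ℤ) i (-i + n) n (by simp)).hom.comp
    ((rankOneEquiv (P.X (-i)) (Q.X (-i + n))).symm.toAddMonoidHom.comp
      (AddMonoidHom.mk' (fun z => (i * (-i + n)).negOnePow • z.v (-i) (-i + n) rfl)
        (fun z z' => smul_add _ (z.v (-i) (-i + n) rfl) (z'.v (-i) (-i + n) rfl))))

lemma tensorComponent_eq_zero {n i : ℤ} {z : Cochain P Q n} (hz : z.v (-i) (-i + n) rfl = 0) :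
    tensorComponent P Q n i z = 0 := by
  refine (congrArg (fun g => (HomologicalComplex.ιMapBifunctor (dual P) (underlying Q)
    (tensorBifunctor R) (ComplexShape.up ℤ) i (-i + n) n (by simp)).hom
      ((rankOneEquiv (P.X (-i)) (Q.X (-i + n))).symm ((i * (-i + n)).negOnePow • g))) hz).trans ?_
  rw [smul_zero, map_zero]
  exact map_zero _

/-- The tensor corresponding to a bounded cochain. -/
noncomputable def tensorOfBounded (n : ℤ) :
    boundedCochains P Q n →+ (tensorComplex R (dual P) (underlying Q)).X n :=
  -- `∑ᶠ` takes the value zero on infinite support, so additivity needs this finiteness.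
  have hfin (z : boundedCochains P Q n) :
      (Function.support (fun i => tensorComponent P Q n i z.1)).Finite :=
    (Set.Finite.preimage (f := fun i : ℤ => -i) (fun _ _ _ _ h => by simpa using h) z.2).subset
      (fun _ hi h => hi (tensorComponent_eq_zero P Q h))
  AddMonoidHom.mk' (fun z => ∑ᶠ i, tensorComponent P Q n i z.1) (fun z z' => by
    rw [← finsum_add_distrib (hfin z) (hfin z')]
    exact finsum_congr (fun i => map_add _ _ _))

/-- A left inverse of the canonical map gives its injectivity. It is tested on pure tensors in each
summand, where only one component survives and the two signs cancel. -/
lemma tensorOfBounded_tensorToHom (n : ℤ) (x : (tensorComplex R (dual P) (underlying Q)).X n) :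
    tensorOfBounded P Q n ⟨_, tensorToHom_mem_boundedCochains P Q n x⟩ = x := by
  let a : (tensorComplex R (dual P) (underlying Q)).X n →+
      (tensorComplex R (dual P) (underlying Q)).X n :=
    (tensorOfBounded P Q n).comp (((tensorToHom P Q).f n).hom.codRestrict (boundedCochains P Q n)
      (tensorToHom_mem_boundedCochains P Q n))
  have h : AddCommGrpCat.ofHom a = 𝟙 _ := by
    apply HomologicalComplex.mapBifunctor.hom_ext
    intro i j hij
    obtain rfl : j = -i + n := by dsimp at hij; lia
    apply AddCommGrpCat.hom_ext
    refine BalancedTensor.hom_ext (fun f y => ?_)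
    have e : ((tensorToHom P Q).f n).hom ((HomologicalComplex.ιMapBifunctor (dual P)
        (underlying Q) (tensorBifunctor R) (ComplexShape.up ℤ) i (-i + n) n hij).hom
          (BalancedTensor.tmul R f y)) =
        (i * (-i + n)).negOnePow • (Cochain.single (rankOne f y) n : Cochain P Q n) :=
      DFunLike.congr_fun (congrArg AddCommGrpCat.Hom.hom (HomologicalComplex.ι_mapBifunctorDesc
        (fun i j _ => tensorToHomX P Q i j n) i (-i + n) hij)) (BalancedTensor.tmul R f y)
    refine (finsum_congr (fun k => congrArg (tensorComponent P Q n k) e)).trans ?_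
    rw [finsum_eq_single _ i]
    · change (HomologicalComplex.ιMapBifunctor (dual P) (underlying Q) (tensorBifunctor R)
        (ComplexShape.up ℤ) i (-i + n) n hij).hom ((rankOneEquiv _ _).symm _) = _
      have e' : (i * (-i + n)).negOnePow • ((i * (-i + n)).negOnePow •
          (Cochain.single (rankOne f y) n : Cochain P Q n)).v (-i) (-i + n) rfl = rankOne f y := by
        rw [Cochain.units_smul_v, smul_smul, Int.units_mul_self, one_smul, Cochain.single_v]
      refine (congrArg (fun g => (HomologicalComplex.ιMapBifunctor (dual P) (underlying Q)
        (tensorBifunctor R) (ComplexShape.up ℤ) i (-i + n) n hij).hom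
          ((rankOneEquiv (P.X (-i)) (Q.X (-i + n))).symm g)) e').trans ?_
      exact congrArg (HomologicalComplex.ιMapBifunctor (dual P) (underlying Q)
        (tensorBifunctor R) (ComplexShape.up ℤ) i (-i + n) n hij).hom
          (rankOneEquiv_symm_rankOne (P.X (-i)) (Q.X (-i + n)) f y)
    · intro k hk
      apply tensorComponent_eq_zero
      rw [Cochain.units_smul_v, Cochain.single_v_eq_zero _ _ _ _ _ (by simpa using hk), smul_zero]
  exact DFunLike.congr_fun (congrArg AddCommGrpCat.Hom.hom h) x

lemma homSequence_shortExact : (homSequence P Q).ShortExact := by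
  apply HomologicalComplex.shortExact_of_degreewise_shortExact
  intro n
  have hm : Mono ((tensorToHom P Q).f n) := by
    rw [AddCommGrpCat.mono_iff_injective]
    intro x y hxy
    rw [← tensorOfBounded_tensorToHom P Q n x, ← tensorOfBounded_tensorToHom P Q n y]
    exact congrArg (tensorOfBounded P Q n) (Subtype.ext hxy)
  have he : Epi ((toHomHat P Q).f n) := by
    rw [AddCommGrpCat.epi_iff_surjective]
    exact hatMk_surjective P Q n
  exact
    { exact := (ShortComplex.ab_exact_iff _).2 (fun z hz => mem_range_of_mem_boundedCochains P Q
        (hatMk_eq_zero_iff.1 hz))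
      mono_f := hm
      epi_g := he }

end ShortExact

/-! ### The connecting map and transport of exactness. -/

namespace KMinusB

variable {R : Type u} [Ring R] (P Q : KMinusB R)

/-- The connecting map `Hom_{D_sg(R)}(P, Σⁿ Q) ⟶ Tor_{-n-1}^R(P*, Q)`. -/
noncomputable def connectingMap (n : ℤ) :
    ShiftedHom ((quotientFunctor R).obj P) ((quotientFunctor R).obj Q) n →+ tor P Q (-n - 1) :=
  ((hyperTorEquiv (dual P.complex) (underlying Q.complex) (n + 1) (-n - 1)
    (by ring)).toAddMonoidHom.comp
      ((homSequence_shortExact P.complex Q.complex).δ n (n + 1) rfl).hom).comp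
        (homologyHatEquiv P Q n).symm.toAddMonoidHom

/-- Exactness of a pair of maps is preserved by isomorphisms of the three groups. -/
lemma exact_of_addEquiv {A B C A' B' C' : Type*} [AddCommGroup A] [AddCommGroup B] [AddCommGroup C]
    [AddCommGroup A'] [AddCommGroup B'] [AddCommGroup C'] {f : A →+ B} {g : B →+ C}
    {f' : A' →+ B'} {g' : B' →+ C'} (a : A ≃+ A') (b : B ≃+ B') (c : C ≃+ C')
    (hf : ∀ x, f' (a x) = b (f x)) (hg : ∀ y, g' (b y) = c (g y)) (h : Function.Exact f g) :
    Function.Exact f' g' := by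
  intro y'
  obtain ⟨y, rfl⟩ := b.surjective y'
  rw [hg, c.map_eq_zero_iff, h y]
  constructor
  · rintro ⟨x, rfl⟩
    exact ⟨a x, hf x⟩
  · rintro ⟨x', hx'⟩
    obtain ⟨x, rfl⟩ := a.surjective x'
    exact ⟨x, b.injective ((hf x).symm.trans hx')⟩

lemma torToHom_hyperTorEquiv (n m : ℤ) (h : m = -n)
    (x : (tensorComplex R (dual P.complex) (underlying Q.complex)).homology n) :
    torToHom P Q m n h (hyperTorEquiv _ _ n m h x) = homologyHomEquiv P Q n
      ((HomologicalComplex.homologyMap (tensorToHom P.complex Q.complex) n).hom x) :=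
  congrArg (fun y => homologyHomEquiv P Q n
      ((HomologicalComplex.homologyMap (tensorToHom P.complex Q.complex) n).hom y))
    ((hyperTorEquiv _ _ n m h).symm_apply_apply x)

lemma connectingMap_homologyHatEquiv (n : ℤ) (x : (homHat P.complex Q.complex).homology n) :
    connectingMap P Q n (homologyHatEquiv P Q n x) =
      hyperTorEquiv (dual P.complex) (underlying Q.complex) (n + 1) (-n - 1) (by ring)
        (((homSequence_shortExact P.complex Q.complex).δ n (n + 1) rfl).hom x) :=
  congrArg (fun y => hyperTorEquiv (dual P.complex) (underlying Q.complex) (n + 1) (-n - 1)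
      (by ring) (((homSequence_shortExact P.complex Q.complex).δ n (n + 1) rfl).hom y))
    ((homologyHatEquiv P Q n).symm_apply_apply x)

end KMinusB

end SingularityLES

open CategoryTheory SingularityLES in
theorem theorem4p3 (R : Type u) [Ring R] (P Q : KMinusB R) :
    ∃ (hS : (homSequence P.complex Q.complex).ShortExact)
      (e : ∀ n : ℤ, (homHat P.complex Q.complex).homology n ≃+
        ShiftedHom ((quotientFunctor R).obj P) ((quotientFunctor R).obj Q) n)
      (δ : ∀ n : ℤ, ShiftedHom ((quotientFunctor R).obj P) ((quotientFunctor R).obj Q) n →+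
        KMinusB.tor P Q (-n - 1)),
      (∀ n : ℤ, Function.Exact (KMinusB.torToHom P Q (-n) n rfl) (KMinusB.quotientMap P Q n)) ∧
      (∀ n : ℤ, Function.Exact (KMinusB.quotientMap P Q n) (δ n)) ∧
      (∀ n : ℤ, Function.Exact (δ n) (KMinusB.torToHom P Q (-n - 1) (n + 1) (by ring))) ∧
      (∀ (n : ℤ) (x : (CochainComplex.HomComplex P.complex Q.complex).homology n),
        e n ((HomologicalComplex.homologyMap (toHomHat P.complex Q.complex) n).hom x) =
          KMinusB.quotientMap P Q n (KMinusB.homologyHomEquiv P Q n x)) ∧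
      (∀ (n : ℤ) (x : (homHat P.complex Q.complex).homology n),
        δ n (e n x) = hyperTorEquiv (dual P.complex) (underlying Q.complex) (n + 1) (-n - 1)
          (by ring) ((hS.δ n (n + 1) rfl).hom x)) := by
  -- The three exactness claims are those of the long cohomology sequence of `hS`, at the middle,
  -- right and left terms in turn.
  have hS := homSequence_shortExact P.complex Q.complex
  refine ⟨hS, KMinusB.homologyHatEquiv P Q, KMinusB.connectingMap P Q, fun n => ?_, fun n => ?_,
    fun n => ?_, fun n x => KMinusB.homologyHatEquiv_homologyMap x,
    KMinusB.connectingMap_homologyHatEquiv P Q⟩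
  · exact KMinusB.exact_of_addEquiv (hyperTorEquiv _ _ n (-n) rfl) (KMinusB.homologyHomEquiv P Q n)
      (KMinusB.homologyHatEquiv P Q n) (KMinusB.torToHom_hyperTorEquiv P Q n (-n) rfl)
      (fun x => (KMinusB.homologyHatEquiv_homologyMap x).symm)
      ((ShortComplex.ab_exact_iff_function_exact _).1 (hS.homology_exact₂ n))
  · exact KMinusB.exact_of_addEquiv (KMinusB.homologyHomEquiv P Q n)
      (KMinusB.homologyHatEquiv P Q n) (hyperTorEquiv _ _ (n + 1) (-n - 1) (by ring))
      (fun x => (KMinusB.homologyHatEquiv_homologyMap x).symm)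
      (KMinusB.connectingMap_homologyHatEquiv P Q n)
      ((ShortComplex.ab_exact_iff_function_exact _).1 (hS.homology_exact₃ n (n + 1) rfl))
  · exact KMinusB.exact_of_addEquiv (KMinusB.homologyHatEquiv P Q n)
      (hyperTorEquiv _ _ (n + 1) (-n - 1) (by ring)) (KMinusB.homologyHomEquiv P Q (n + 1))
      (KMinusB.connectingMap_homologyHatEquiv P Q n)
      (KMinusB.torToHom_hyperTorEquiv P Q (n + 1) (-n - 1) (by ring))
      ((ShortComplex.ab_exact_iff_function_exact _).1 (hS.homology_exact₁ n (n + 1) rfl))
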